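/- **Setting.** Let $p_1,p_2,n,r$ be integers with $r\ge 1$, let $\mathbf A_1,\dots,\mathbf A_n\in\mathbb R^{p_1\times p_2}$, $\mathbf y\in\mathbb R^n$, and let $\mathcal A:\mathbb R^{p_1\times p_2}\to\mathbb R^n$, $\mathcal A(\mathbf X)=(\langle \mathbf A_1,\mathbf X\rangle,\dots,\langle \mathbf A_n,\mathbf X\rangle)^\top$, with $\langle\cdot,\cdot\rangle$ the trace inner product, and $\mathcal A^*(z)=\sum_i z_i\mathbf A_i$ its adjoint. $\|\cdot\|_F$ is the Frobenius norm, $\|\cdot\|$ the spectral norm, $\sigma_r(\cdot)$ the $r$-th largest singular value. For $k\ge1$ let $R_k$ be the smallest number with $(1-R_k)\|\mathbf Z\|_F^2\le\|\mathcal A(\mathbf Z)\|_2^2\le(1+R_k)\|\mathbf Z\|_F^2$ for all $\mathbf Z\in\mathbb R^{p_1\times p_2}$ of rank at most $k$ (if $k>\min(p_1,p_2)$, for all $\mathbf Z$); $\mathcal A$ satisfies $k$-RIP if $0\le R_k<1$. A matrix $\bar{\mathbf X}$ of rank $r$ with singular value decomposition $\bar{\mathbf U}\bar{\boldsymbol\Sigma}\bar{\mathbf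 V}^\top$ ($\bar{\mathbf U}\in\mathbb R^{p_1\times r}$, $\bar{\mathbf V}\in\mathbb R^{p_2\times r}$ with orthonormal columns) is a *stationary point* of $\min\{f(\mathbf X)=\tfrac12\|\mathbf y-\mathcal A(\mathbf X)\|_2^2:\operatorname{rank}\mathbf X=r\}$ if $\nabla f(\bar{\mathbf X})^\top\bar{\mathbf U}=0$ and $\nabla f(\bar{\mathbf X})\bar{\mathbf V}=0$, where $\nabla f(\bar{\mathbf X})=\mathcal A^*(\mathcal A(\bar{\mathbf X})-\mathbf y)$. *RISRO* generates a sequence $\{\mathbf X^t\}_{t\ge0}$ as follows. Start from $\mathbf X^0=\mathbf U^0\boldsymbol\Sigma^0\mathbf V^{0\top}$, a singular value decomposition with $\mathbf U^0\in\mathbb R^{p_1\times r}$, $\mathbf V^0\in\mathbb R^{p_2\times r}$ having orthonormal columns and $\boldsymbol\Sigma^0\in\mathbb R^{r\times r}$ diagonal and nonnegative. For $t=0,1,\dots$, let $\mathbf U^t_\perp,\mathbf V^t_\perp$ be orthonormal complements of $\mathbf U^t,\mathbf V^t$, and let $(\mathbf B^{t+1},\mathbf D_1^{t+1},\mathbf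 D_2^{t+1})$ minimize, over $\mathbf B\in\mathbb R^{r\times r}$, $\mathbf D_i\in\mathbb R^{(p_i-r)\times r}$, $$\sum_{i=1}^n\Big(y_i-\langle \mathbf B,\mathbf U^{t\top}\mathbf A_i\mathbf V^t\rangle-\langle \mathbf D_1,\mathbf U_\perp^{t\top}\mathbf A_i\mathbf V^t\rangle-\langle \mathbf D_2^\top,\mathbf U^{t\top}\mathbf A_i\mathbf V_\perp^t\rangle\Big)^2 .$$ Put $\mathbf X_U^{t+1}=\mathbf U^t\mathbf B^{t+1}+\mathbf U^t_\perp\mathbf D_1^{t+1}$ and $\mathbf X_V^{t+1}=\mathbf V^t\mathbf B^{t+1\top}+\mathbf V^t_\perp\mathbf D_2^{t+1}$; let $\mathbf U^{t+1},\mathbf V^{t+1}$ be the orthonormal factors of QR decompositions of $\mathbf X_U^{t+1},\mathbf X_V^{t+1}$; and put $\mathbf X^{t+1}=\mathbf X_U^{t+1}(\mathbf B^{t+1})^\dagger\mathbf X_V^{t+1\top}$, with $\dagger$ the Moore–Penrose inverse. **Theorem (Local Quadratic-Linear and Quadratic Convergence of RISRO).** Let $\bar{\mathbf X}$ be a stationary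 point (of rank $r$) and $\bar{\boldsymbol\epsilon}=\mathbf y-\mathcal A(\bar{\mathbf X})$. Suppose that $\mathcal A$ satisfies $2r$-RIP, that $$\|\mathbf X^0-\bar{\mathbf X}\|_F\le\min\Big\{\frac14,\frac{1-R_{2r}}{4\sqrt5\,R_{3r}}\Big\}\sigma_r(\bar{\mathbf X})$$ (the second term being read as $+\infty$ if $R_{3r}=0$), and that $\|\mathcal A^*(\bar{\boldsymbol\epsilon})\|_F\le\frac{1-R_{2r}}{4\sqrt5}\sigma_r(\bar{\mathbf X})$. Then every sequence $\{\mathbf X^t\}$ generated by RISRO from $\mathbf X^0$ converges to $\bar{\mathbf X}$, and for all $t\ge0$ $$\|\mathbf X^{t+1}-\bar{\mathbf X}\|_F\le\tfrac34\|\mathbf X^t-\bar{\mathbf X}\|_F,$$ $$\|\mathbf X^{t+1}-\bar{\mathbf X}\|_F^2\le\frac{5\|\mathbf X^t-\bar{\mathbf X}\|^2}{(1-R_{2r})^2\sigma_r^2(\bar{\mathbf X})}\Big(R_{3r}^2\|\mathbf X^t-\bar{\mathbf X}\|_F^2+4R_{3r}\|\mathcal A^*(\bar{\boldsymbol\epsilon})\|_F\|\mathbf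 X^t-\bar{\mathbf X}\|_F+4\|\mathcal A^*(\bar{\boldsymbol\epsilon})\|_F^2\Big).$$ If $\bar{\boldsymbol\epsilon}=0$, then for all $t\ge0$ $$\|\mathbf X^{t+1}-\bar{\mathbf X}\|_F\le\frac{\sqrt5\,R_{3r}}{(1-R_{2r})\sigma_r(\bar{\mathbf X})}\|\mathbf X^t-\bar{\mathbf X}\|_F^2 .$$ -/

import Mathlib

open Filter Topology
open scoped Matrix

namespace Risro

/-! ### Matrix norms and singular values -/

section Frobenius
open scoped Matrix.Norms.Frobenius

/-- The Frobenius norm of a real matrix. -/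
noncomputable def frobNorm {p q : ℕ} (M : Matrix (Fin p) (Fin q) ℝ) : ℝ := ‖M‖

end Frobenius

section Spectral
open scoped Matrix.Norms.L2Operator

/-- The spectral norm (largest singular value) of a real matrix, i.e. its operator norm for the
Euclidean norms. -/
noncomputable def specNorm {p q : ℕ} (M : Matrix (Fin p) (Fin q) ℝ) : ℝ := ‖M‖

end Spectral

/-- The `k`-th largest singular value `σ_k(M)` for `k ≥ 1` (Mathlib counts them from `0`). -/
noncomputable def sigma {p q : ℕ} (k : ℕ) (M : Matrix (Fin p) (Fin q) ℝ) : ℝ :=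
  (Matrix.toEuclideanLin M).singularValues (k - 1)

/-! ### Linear measurements -/

/-- The trace inner product `⟨M, N⟩ = ∑ M_jk N_jk`. -/
def frobInner {p q : ℕ} (M N : Matrix (Fin p) (Fin q) ℝ) : ℝ := ∑ j, ∑ k, M j k * N j k

/-- The linear map `Z ↦ (⟨C₁, Z⟩, …, ⟨Cₙ, Z⟩)` with measurement matrices `C₁, …, Cₙ`. -/
noncomputable def measMap {n p q : ℕ} (C : Fin n → Matrix (Fin p) (Fin q) ℝ) :
    Matrix (Fin p) (Fin q) ℝ →ₗ[ℝ] EuclideanSpace ℝ (Fin n) where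
  toFun Z := WithLp.toLp 2 fun i => frobInner (C i) Z
  map_add' Z W := by
    ext i
    simp [frobInner, mul_add, Finset.sum_add_distrib]
  map_smul' c Z := by
    ext i
    simp [frobInner, Finset.mul_sum, mul_left_comm]

/-- The adjoint `z ↦ ∑ i, z_i C_i` of `measMap C`. -/
noncomputable def measAdj {n p q : ℕ} (C : Fin n → Matrix (Fin p) (Fin q) ℝ)
    (z : EuclideanSpace ℝ (Fin n)) : Matrix (Fin p) (Fin q) ℝ := ∑ i, z i • C i

theorem inner_measMap {n p q : ℕ} (C : Fin n → Matrix (Fin p) (Fin q) ℝ)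
    (Z : Matrix (Fin p) (Fin q) ℝ) (z : EuclideanSpace ℝ (Fin n)) :
    inner ℝ (measMap C Z) z = frobInner Z (measAdj C z) := by
  simp only [measMap, frobInner, measAdj, PiLp.inner_apply, LinearMap.coe_mk, AddHom.coe_mk,
    Matrix.sum_apply, Matrix.smul_apply, smul_eq_mul, Finset.mul_sum, Real.inner_apply,
    Finset.sum_mul]
  rw [Finset.sum_comm]
  refine Finset.sum_congr rfl fun j _ => ?_
  rw [Finset.sum_comm]
  refine Finset.sum_congr rfl fun k _ => Finset.sum_congr rfl fun i _ => ?_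
  ring

/-! ### Restricted isometry property -/

/-- `δ` is an admissible constant in the two-sided isometry inequality for rank at most `k`. -/
def IsRestrictedIsometryBound {n p q : ℕ} (A : Fin n → Matrix (Fin p) (Fin q) ℝ) (k : ℕ)
    (δ : ℝ) : Prop :=
  ∀ Z : Matrix (Fin p) (Fin q) ℝ, Z.rank ≤ k →
    (1 - δ) * frobNorm Z ^ 2 ≤ ‖measMap A Z‖ ^ 2 ∧
      ‖measMap A Z‖ ^ 2 ≤ (1 + δ) * frobNorm Z ^ 2

/-- The `k`-restricted isometry constant `R_k`, the smallest admissible constant (the minimum is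
attained, see `isLeast_ricConst`). For `k > min p q` the rank restriction is void and
`R_k = R_{min p q}`. -/
noncomputable def ricConst {n p q : ℕ} (A : Fin n → Matrix (Fin p) (Fin q) ℝ) (k : ℕ) : ℝ :=
  sInf {δ : ℝ | IsRestrictedIsometryBound A k δ}

/-- The `k`-restricted isometry property. -/
def RIP {n p q : ℕ} (A : Fin n → Matrix (Fin p) (Fin q) ℝ) (k : ℕ) : Prop :=
  0 ≤ ricConst A k ∧ ricConst A k < 1

section Bound
open scoped Matrix.Norms.Frobenius

theorem measMap_bound {n p q : ℕ} (A : Fin n → Matrix (Fin p) (Fin q) ℝ) :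
    ∃ c : ℝ, ∀ Z, ‖measMap A Z‖ ≤ c * frobNorm Z :=
  ⟨_, fun Z => (LinearMap.toContinuousLinearMap (measMap A)).le_opNorm Z⟩

theorem frobNorm_pos {p q : ℕ} {Z : Matrix (Fin p) (Fin q) ℝ} (hZ : Z ≠ 0) : 0 < frobNorm Z :=
  norm_pos_iff.2 hZ

end Bound

theorem isLeast_ricConst {n p q : ℕ} (A : Fin n → Matrix (Fin p) (Fin q) ℝ) (k : ℕ)
    (hp : 1 ≤ p) (hq : 1 ≤ q) (hk : 1 ≤ k) :
    IsLeast {δ : ℝ | IsRestrictedIsometryBound A k δ} (ricConst A k) := by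
  have hclosed : IsClosed {δ : ℝ | IsRestrictedIsometryBound A k δ} := by
    simp only [IsRestrictedIsometryBound, Set.ofPred_forall]
    refine isClosed_iInter fun Z => isClosed_iInter fun _ => ?_
    rw [Set.ofPred_and]
    exact (isClosed_le (by fun_prop) (by fun_prop)).inter (isClosed_le (by fun_prop) (by fun_prop))
  have hne : {δ : ℝ | IsRestrictedIsometryBound A k δ}.Nonempty := by
    obtain ⟨c, hc⟩ := measMap_bound A
    refine ⟨max 1 (c ^ 2), fun Z _ => ⟨?_, ?_⟩⟩
    · have h1 : (1 - max 1 (c ^ 2)) ≤ 0 := by linarith [le_max_left 1 (c ^ 2)]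
      nlinarith [sq_nonneg (frobNorm Z), sq_nonneg ‖measMap A Z‖]
    · have h3 : ‖measMap A Z‖ ^ 2 ≤ (c * frobNorm Z) ^ 2 :=
        pow_le_pow_left₀ (norm_nonneg _) (hc Z) 2
      have h4 := le_max_right 1 (c ^ 2)
      nlinarith [sq_nonneg (frobNorm Z)]
  have hbdd : BddBelow {δ : ℝ | IsRestrictedIsometryBound A k δ} := by
    refine ⟨0, fun δ hδ => ?_⟩
    let Z : Matrix (Fin p) (Fin q) ℝ := Matrix.vecMulVec (fun _ => 1) (fun _ => 1)
    have hZ : Z.rank ≤ k := (Matrix.rank_vecMulVec_le _ _).trans hk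
    have hpos : 0 < frobNorm Z ^ 2 := by
      have hZ0 : Z ≠ 0 := fun h => by
        have := congrFun (congrFun h ⟨0, hp⟩) ⟨0, hq⟩
        simp [Z, Matrix.vecMulVec] at this
      have : 0 < frobNorm Z := frobNorm_pos hZ0
      positivity
    obtain ⟨h1, h2⟩ := hδ Z hZ
    nlinarith
  exact ⟨hclosed.csInf_mem hne hbdd, fun δ hδ => csInf_le hbdd hδ⟩

/-! ### Matrix factorizations -/

/-- `U ∈ 𝕆_{p,r}`: the columns of `U` are orthonormal. -/
def OrthonormalCols {p r : ℕ} (U : Matrix (Fin p) (Fin r) ℝ) : Prop := Uᵀ * U = 1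

/-- `W` is an orthonormal complement `U_⊥ ∈ 𝕆_{p,p-r}` of `U ∈ 𝕆_{p,r}`. -/
def IsOrthoComplement {p r : ℕ} (U : Matrix (Fin p) (Fin r) ℝ)
    (W : Matrix (Fin p) (Fin (p - r)) ℝ) : Prop :=
  OrthonormalCols W ∧ Uᵀ * W = 0

/-- `X = U diag(s) Vᵀ` is a singular value decomposition with `r` singular triples
(the order of the triples is immaterial). -/
def IsSVD {p q r : ℕ} (X : Matrix (Fin p) (Fin q) ℝ) (U : Matrix (Fin p) (Fin r) ℝ)
    (s : Fin r → ℝ) (V : Matrix (Fin q) (Fin r) ℝ) : Prop :=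
  OrthonormalCols U ∧ OrthonormalCols V ∧ (∀ i, 0 ≤ s i) ∧ X = U * Matrix.diagonal s * Vᵀ

/-- `Q` is the orthonormal part of a QR decomposition `X = Q R`, `R` upper triangular. -/
def IsQR {p r : ℕ} (X Q : Matrix (Fin p) (Fin r) ℝ) : Prop :=
  OrthonormalCols Q ∧ ∃ R : Matrix (Fin r) (Fin r) ℝ, R.BlockTriangular id ∧ X = Q * R

/-- `P` is the Moore-Penrose inverse of `M` (the four Penrose equations). -/
def IsMoorePenrose {p q : ℕ} (M : Matrix (Fin p) (Fin q) ℝ) (P : Matrix (Fin q) (Fin p) ℝ) :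
    Prop :=
  M * P * M = M ∧ P * M * P = P ∧ (M * P)ᵀ = M * P ∧ (P * M)ᵀ = P * M

/-! ### The algorithm -/

/-- The objective of the dimension-reduced least squares problem,
`‖y - 𝒜_B(B) - 𝒜_{D₁}(D₁) - 𝒜_{D₂}(D₂ᵀ)‖²`, with the importance covariates
`Uᵀ A_i V`, `U_⊥ᵀ A_i V` and `Uᵀ A_i V_⊥`. -/
noncomputable def sketchedLoss {n p q r : ℕ} (A : Fin n → Matrix (Fin p) (Fin q) ℝ)
    (y : EuclideanSpace ℝ (Fin n))
    (U : Matrix (Fin p) (Fin r) ℝ) (Up : Matrix (Fin p) (Fin (p - r)) ℝ)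
    (V : Matrix (Fin q) (Fin r) ℝ) (Vp : Matrix (Fin q) (Fin (q - r)) ℝ)
    (B : Matrix (Fin r) (Fin r) ℝ) (D₁ : Matrix (Fin (p - r)) (Fin r) ℝ)
    (D₂ : Matrix (Fin (q - r)) (Fin r) ℝ) : ℝ :=
  ‖y - measMap (fun i => Uᵀ * A i * V) B - measMap (fun i => Upᵀ * A i * V) D₁
      - measMap (fun i => Uᵀ * A i * Vp) D₂ᵀ‖ ^ 2

/-- One iteration of RISRO: from the sketching matrices `U, V` to `U', V'` and the iterate `X'`.
Every admissible choice of orthonormal complements, of the least squares minimizer and of the QR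
factors is allowed. -/
def IsRisroStep {n p q r : ℕ} (A : Fin n → Matrix (Fin p) (Fin q) ℝ)
    (y : EuclideanSpace ℝ (Fin n))
    (U : Matrix (Fin p) (Fin r) ℝ) (V : Matrix (Fin q) (Fin r) ℝ)
    (U' : Matrix (Fin p) (Fin r) ℝ) (V' : Matrix (Fin q) (Fin r) ℝ)
    (X' : Matrix (Fin p) (Fin q) ℝ) : Prop :=
  ∃ (Up : Matrix (Fin p) (Fin (p - r)) ℝ) (Vp : Matrix (Fin q) (Fin (q - r)) ℝ)
    (B Bdag : Matrix (Fin r) (Fin r) ℝ) (D₁ : Matrix (Fin (p - r)) (Fin r) ℝ)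
    (D₂ : Matrix (Fin (q - r)) (Fin r) ℝ) (XU : Matrix (Fin p) (Fin r) ℝ)
    (XV : Matrix (Fin q) (Fin r) ℝ),
    IsOrthoComplement U Up ∧ IsOrthoComplement V Vp ∧
    (∀ (C : Matrix (Fin r) (Fin r) ℝ) (E₁ : Matrix (Fin (p - r)) (Fin r) ℝ)
      (E₂ : Matrix (Fin (q - r)) (Fin r) ℝ),
      sketchedLoss A y U Up V Vp B D₁ D₂ ≤ sketchedLoss A y U Up V Vp C E₁ E₂) ∧
    XU = U * B + Up * D₁ ∧ XV = V * Bᵀ + Vp * D₂ ∧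
    IsQR XU U' ∧ IsQR XV V' ∧
    IsMoorePenrose B Bdag ∧ X' = XU * Bdag * XVᵀ

/-- `X 0, X 1, …` is a sequence generated by RISRO with rank parameter `r`, started from the
singular value decomposition of `X 0`. -/
def IsRisroSequence {n p q : ℕ} (A : Fin n → Matrix (Fin p) (Fin q) ℝ)
    (y : EuclideanSpace ℝ (Fin n)) (r : ℕ) (X : ℕ → Matrix (Fin p) (Fin q) ℝ) : Prop :=
  ∃ (U : ℕ → Matrix (Fin p) (Fin r) ℝ) (V : ℕ → Matrix (Fin q) (Fin r) ℝ),
    (∃ s : Fin r → ℝ, IsSVD (X 0) (U 0) s (V 0)) ∧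
    ∀ t, IsRisroStep A y (U t) (V t) (U (t + 1)) (V (t + 1)) (X (t + 1))

/-! ### Stationary points -/

/-- The gradient `𝒜*(𝒜(X) - y)` of `f(X) = ‖y - 𝒜(X)‖² / 2`. -/
noncomputable def lsGradient {n p q : ℕ} (A : Fin n → Matrix (Fin p) (Fin q) ℝ)
    (y : EuclideanSpace ℝ (Fin n)) (X : Matrix (Fin p) (Fin q) ℝ) : Matrix (Fin p) (Fin q) ℝ :=
  measAdj A (measMap A X - y)

/-- `X` is a stationary point of `min f(X)` subject to `rank X = r`: it has rank `r`, and
`∇f(X)ᵀ U = 0`, `∇f(X) V = 0` for its left and right singular vectors `U`, `V`. -/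
def IsStationary {n p q : ℕ} (A : Fin n → Matrix (Fin p) (Fin q) ℝ)
    (y : EuclideanSpace ℝ (Fin n)) (r : ℕ) (X : Matrix (Fin p) (Fin q) ℝ) : Prop :=
  X.rank = r ∧
  ∃ (U : Matrix (Fin p) (Fin r) ℝ) (s : Fin r → ℝ) (V : Matrix (Fin q) (Fin r) ℝ),
    IsSVD X U s V ∧ (lsGradient A y X)ᵀ * U = 0 ∧ lsGradient A y X * V = 0

end Risro

namespace Risro

/-! The reduced least squares problem is the full one restricted to the tangent space `T` of
matrices `U L + R Vᵀ`, and the update is `X' = Z V (Uᵀ Z V)† Uᵀ Z`, where `Z` is the least squares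
solution (`IsRisroStep.exists_tangent`). Write `P = 1 - U Uᵀ`, `Q = 1 - V Vᵀ`, `σ = σ_r(Xb)`, `G =
𝒜*(y - 𝒜 Xb)`. Split off the normal part `W = P Xb Q` of the target and put `D = Z - (Xb - W)`,
which lies in `T`.

Testing the optimality of `Z` against `D` gives `‖𝒜 D‖² = ⟨𝒜 W, 𝒜 D⟩ + ⟨G, D⟩`. Both terms on the
right are small. The column spaces of `U` and `Ub` differ by a sine of at most `‖X - Xb‖ / σ`,
likewise on the right, so `‖W‖_F ≤ ‖X - Xb‖ ‖X - Xb‖_F / σ`, a second-order quantity. Stationarity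
says that `G` annihilates `Ub` and `Vb`, so its tangential part has the factor `‖X - Xb‖ / σ` too.
As `D ⊥ W` have ranks at most `2r` and `r`, restricted isometry yields `(1 - R_{2r}) ‖D‖_F ≤ ‖X -
Xb‖ / σ * (R_{3r} ‖X - Xb‖_F + 2 ‖G‖_F)` (`frobNorm_tangent_error_le`).

Since `Xb` has rank `r`, it is reproduced exactly by `Xb V (Uᵀ Xb V)⁻¹ Uᵀ Xb`. Comparing this with
the formula for `X'` gives an identity in which every term of `X' - Xb` has a factor `D`
(`update_error_eq`), whence `‖X' - Xb‖_F ≤ √5 ‖D‖_F` (`frobNorm_update_error_le`). The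
initialization turns this into contraction by `3/4`, which preserves the hypotheses for the next
step. -/

variable {n p q r m : ℕ}

/-! ### Frobenius inner product and norm -/

theorem frobInner_comm (M N : Matrix (Fin p) (Fin q) ℝ) : frobInner M N = frobInner N M := by
  simp [frobInner, mul_comm]

theorem frobInner_eq_trace (M N : Matrix (Fin p) (Fin q) ℝ) :
    frobInner M N = (Mᵀ * N).trace := by
  simp only [frobInner, Matrix.trace, Matrix.diag, Matrix.mul_apply, Matrix.transpose_apply]
  exact Finset.sum_comm

theorem frobInner_add_right (M N K : Matrix (Fin p) (Fin q) ℝ) :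
    frobInner M (N + K) = frobInner M N + frobInner M K := by
  simp [frobInner, mul_add, Finset.sum_add_distrib]

theorem frobInner_add_left (M N K : Matrix (Fin p) (Fin q) ℝ) :
    frobInner (M + N) K = frobInner M K + frobInner N K := by
  simp [frobInner, add_mul, Finset.sum_add_distrib]

theorem frobInner_smul_left (c : ℝ) (M N : Matrix (Fin p) (Fin q) ℝ) :
    frobInner (c • M) N = c * frobInner M N := by
  simp [frobInner, Finset.mul_sum, mul_assoc]

theorem frobInner_smul_right (c : ℝ) (M N : Matrix (Fin p) (Fin q) ℝ) :
    frobInner M (c • N) = c * frobInner M N := by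
  rw [frobInner_comm, frobInner_smul_left, frobInner_comm]

@[simp] theorem frobInner_zero_right (M : Matrix (Fin p) (Fin q) ℝ) : frobInner M 0 = 0 := by
  simp [frobInner]

theorem frobInner_mul_left (L : Matrix (Fin p) (Fin m) ℝ) (M : Matrix (Fin m) (Fin q) ℝ)
    (N : Matrix (Fin p) (Fin q) ℝ) : frobInner (L * M) N = frobInner M (Lᵀ * N) := by
  rw [frobInner_eq_trace, frobInner_eq_trace, Matrix.transpose_mul, Matrix.mul_assoc]

theorem frobInner_transpose (M N : Matrix (Fin p) (Fin q) ℝ) :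
    frobInner Mᵀ Nᵀ = frobInner M N := by
  simp only [frobInner, Matrix.transpose_apply]
  exact Finset.sum_comm

theorem frobInner_mul_right (M : Matrix (Fin p) (Fin m) ℝ) (L : Matrix (Fin m) (Fin q) ℝ)
    (N : Matrix (Fin p) (Fin q) ℝ) : frobInner (M * L) N = frobInner M (N * Lᵀ) := by
  rw [← frobInner_transpose, Matrix.transpose_mul, frobInner_mul_left, ← frobInner_transpose]
  simp

theorem frobNorm_nonneg (M : Matrix (Fin p) (Fin q) ℝ) : 0 ≤ frobNorm M :=
  @norm_nonneg _ Matrix.frobeniusSeminormedAddCommGroup.toSeminormedAddGroup M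

theorem frobNorm_add_le (M N : Matrix (Fin p) (Fin q) ℝ) :
    frobNorm (M + N) ≤ frobNorm M + frobNorm N :=
  @norm_add_le _ Matrix.frobeniusSeminormedAddCommGroup.toSeminormedAddGroup M N

theorem frobNorm_neg (M : Matrix (Fin p) (Fin q) ℝ) : frobNorm (-M) = frobNorm M :=
  @norm_neg _ Matrix.frobeniusSeminormedAddCommGroup.toSeminormedAddGroup M

theorem frobNorm_transpose (M : Matrix (Fin p) (Fin q) ℝ) : frobNorm Mᵀ = frobNorm M :=
  Matrix.frobenius_norm_transpose M

theorem frobNorm_sq (M : Matrix (Fin p) (Fin q) ℝ) : frobNorm M ^ 2 = frobInner M M := by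
  have h : 0 ≤ ∑ i, ∑ j, ‖M i j‖ ^ (2 : ℝ) :=
    Finset.sum_nonneg fun i _ => Finset.sum_nonneg fun j _ => by positivity
  rw [frobNorm, Matrix.frobenius_norm_def, ← Real.sqrt_eq_rpow, Real.sq_sqrt h]
  simp [frobInner, ← sq]

theorem frobNorm_smul_sq (c : ℝ) (M : Matrix (Fin p) (Fin q) ℝ) :
    frobNorm (c • M) ^ 2 = c ^ 2 * frobNorm M ^ 2 := by
  rw [frobNorm_sq, frobNorm_sq, frobInner_smul_left, frobInner_smul_right]; ring

theorem frobInner_le (M N : Matrix (Fin p) (Fin q) ℝ) :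
    frobInner M N ≤ frobNorm M * frobNorm N := by
  refine le_of_sq_le_sq ?_ (mul_nonneg (frobNorm_nonneg _) (frobNorm_nonneg _))
  rw [mul_pow, frobNorm_sq, frobNorm_sq]
  simp only [frobInner, ← Finset.sum_product', Finset.univ_product_univ]
  simpa [sq] using Finset.sum_mul_sq_le_sq_mul_sq Finset.univ
    (fun x : Fin p × Fin q => M x.1 x.2) (fun x => N x.1 x.2)

theorem frobNorm_sq_eq_sum_col (M : Matrix (Fin p) (Fin q) ℝ) :
    frobNorm M ^ 2 = ∑ k, ‖WithLp.toLp 2 (M.col k)‖ ^ 2 := by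
  rw [frobNorm_sq, frobInner, Finset.sum_comm]
  simp [EuclideanSpace.norm_sq_eq, ← sq]

/-! ### Spectral norm -/

theorem specNorm_nonneg (M : Matrix (Fin p) (Fin q) ℝ) : 0 ≤ specNorm M :=
  norm_nonneg ((Matrix.toEuclideanLin M).toContinuousLinearMap)

theorem norm_toEuclideanLin_le (M : Matrix (Fin p) (Fin q) ℝ) (x : EuclideanSpace ℝ (Fin q)) :
    ‖Matrix.toEuclideanLin M x‖ ≤ specNorm M * ‖x‖ :=
  ((Matrix.toEuclideanLin M).toContinuousLinearMap).le_opNorm x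

theorem specNorm_le {M : Matrix (Fin p) (Fin q) ℝ} {c : ℝ} (hc : 0 ≤ c)
    (h : ∀ x, ‖Matrix.toEuclideanLin M x‖ ≤ c * ‖x‖) : specNorm M ≤ c :=
  ContinuousLinearMap.opNorm_le_bound ((Matrix.toEuclideanLin M).toContinuousLinearMap) hc h

theorem toEuclideanLin_mul_apply (M : Matrix (Fin p) (Fin m) ℝ) (N : Matrix (Fin m) (Fin q) ℝ)
    (x : EuclideanSpace ℝ (Fin q)) :
    Matrix.toEuclideanLin (M * N) x = Matrix.toEuclideanLin M (Matrix.toEuclideanLin N x) := by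
  simp [Matrix.toLpLin_apply]

theorem toEuclideanLin_one_apply (x : EuclideanSpace ℝ (Fin q)) :
    Matrix.toEuclideanLin (1 : Matrix (Fin q) (Fin q) ℝ) x = x := by
  simp

theorem specNorm_transpose (M : Matrix (Fin p) (Fin q) ℝ) : specNorm Mᵀ = specNorm M := by
  have := Matrix.l2_opNorm_conjTranspose M
  rwa [Matrix.conjTranspose_eq_transpose_of_trivial] at this

theorem specNorm_mul_le (M : Matrix (Fin p) (Fin m) ℝ) (N : Matrix (Fin m) (Fin q) ℝ) :
    specNorm (M * N) ≤ specNorm M * specNorm N :=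
  Matrix.l2_opNorm_mul M N

theorem specNorm_add_le (M N : Matrix (Fin p) (Fin q) ℝ) :
    specNorm (M + N) ≤ specNorm M + specNorm N :=
  @norm_add_le _ Matrix.instL2OpNormedAddCommGroup.toSeminormedAddCommGroup.toSeminormedAddGroup
    M N

theorem specNorm_neg (M : Matrix (Fin p) (Fin q) ℝ) : specNorm (-M) = specNorm M :=
  @norm_neg _ Matrix.instL2OpNormedAddCommGroup.toSeminormedAddCommGroup.toSeminormedAddGroup M

theorem specNorm_mul_le_of_le {M : Matrix (Fin p) (Fin m) ℝ} {N : Matrix (Fin m) (Fin q) ℝ}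
    {a b : ℝ} (ha : specNorm M ≤ a) (hb : specNorm N ≤ b) : specNorm (M * N) ≤ a * b :=
  (specNorm_mul_le M N).trans
    (mul_le_mul ha hb (specNorm_nonneg _) ((specNorm_nonneg _).trans ha))

theorem inner_toEuclideanLin_transpose (M : Matrix (Fin p) (Fin q) ℝ)
    (x : EuclideanSpace ℝ (Fin q)) (y : EuclideanSpace ℝ (Fin p)) :
    inner ℝ (Matrix.toEuclideanLin M x) y = inner ℝ x (Matrix.toEuclideanLin Mᵀ y) := by
  have := Matrix.toEuclideanLin_conjTranspose_eq_adjoint M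
  rw [Matrix.conjTranspose_eq_transpose_of_trivial] at this
  rw [this, LinearMap.adjoint_inner_right]

theorem frobNorm_mul_le_left (M : Matrix (Fin p) (Fin m) ℝ) (N : Matrix (Fin m) (Fin q) ℝ) :
    frobNorm (M * N) ≤ specNorm M * frobNorm N := by
  refine le_of_sq_le_sq ?_ (mul_nonneg (specNorm_nonneg _) (frobNorm_nonneg _))
  rw [mul_pow, frobNorm_sq_eq_sum_col, frobNorm_sq_eq_sum_col, Finset.mul_sum]
  refine Finset.sum_le_sum fun k _ => ?_
  rw [← mul_pow]
  exact pow_le_pow_left₀ (norm_nonneg _) (norm_toEuclideanLin_le M (WithLp.toLp 2 (N.col k))) 2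

theorem frobNorm_mul_le_right (M : Matrix (Fin p) (Fin m) ℝ) (N : Matrix (Fin m) (Fin q) ℝ) :
    frobNorm (M * N) ≤ frobNorm M * specNorm N := by
  rw [← frobNorm_transpose, Matrix.transpose_mul, ← specNorm_transpose N, ← frobNorm_transpose M,
    mul_comm]
  exact frobNorm_mul_le_left _ _

theorem frobNorm_mul_le_left_of_le {M : Matrix (Fin p) (Fin m) ℝ} {N : Matrix (Fin m) (Fin q) ℝ}
    {a b : ℝ} (ha : specNorm M ≤ a) (hb : frobNorm N ≤ b) : frobNorm (M * N) ≤ a * b :=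
  (frobNorm_mul_le_left M N).trans
    (mul_le_mul ha hb (frobNorm_nonneg _) ((specNorm_nonneg _).trans ha))

theorem frobNorm_mul_le_right_of_le {M : Matrix (Fin p) (Fin m) ℝ} {N : Matrix (Fin m) (Fin q) ℝ}
    {a b : ℝ} (ha : frobNorm M ≤ a) (hb : specNorm N ≤ b) : frobNorm (M * N) ≤ a * b :=
  (frobNorm_mul_le_right M N).trans
    (mul_le_mul ha hb (specNorm_nonneg _) ((frobNorm_nonneg _).trans ha))

theorem specNorm_le_frobNorm (M : Matrix (Fin p) (Fin q) ℝ) : specNorm M ≤ frobNorm M := by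
  refine specNorm_le (frobNorm_nonneg _) fun x => ?_
  -- A vector is a one-column matrix, so submultiplicativity of the Frobenius norm bounds the
  -- operator norm.
  have h := Matrix.frobenius_norm_mul M (Matrix.replicateCol (Fin 1) x.ofLp)
  rw [← Matrix.replicateCol_mulVec] at h
  exact (Matrix.frobenius_norm_replicateCol (ι := Fin 1) (M *ᵥ x.ofLp)).ge.trans
    (h.trans_eq (congrArg _ (Matrix.frobenius_norm_replicateCol (ι := Fin 1) x.ofLp)))

/-! ### Orthonormal columns -/

theorem OrthonormalCols.norm_apply {U : Matrix (Fin p) (Fin r) ℝ} (hU : OrthonormalCols U)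
    (x : EuclideanSpace ℝ (Fin r)) : ‖Matrix.toEuclideanLin U x‖ = ‖x‖ := by
  have h : ‖Matrix.toEuclideanLin U x‖ ^ 2 = ‖x‖ ^ 2 := by
    rw [← real_inner_self_eq_norm_sq, ← real_inner_self_eq_norm_sq,
      inner_toEuclideanLin_transpose, ← toEuclideanLin_mul_apply, hU, toEuclideanLin_one_apply]
  exact (sq_eq_sq₀ (norm_nonneg _) (norm_nonneg _)).1 h

theorem OrthonormalCols.specNorm_le_one {U : Matrix (Fin p) (Fin r) ℝ} (hU : OrthonormalCols U) :
    specNorm U ≤ 1 :=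
  specNorm_le zero_le_one fun x => by rw [hU.norm_apply, one_mul]

theorem OrthonormalCols.specNorm_transpose_le_one {U : Matrix (Fin p) (Fin r) ℝ}
    (hU : OrthonormalCols U) : specNorm Uᵀ ≤ 1 := by
  rw [specNorm_transpose]; exact hU.specNorm_le_one

/-- Pythagoras for the splitting of a vector by the column space of `U`. -/
theorem OrthonormalCols.norm_sq_split {U : Matrix (Fin p) (Fin r) ℝ} (hU : OrthonormalCols U)
    (x : EuclideanSpace ℝ (Fin p)) :
    ‖x‖ ^ 2 = ‖Matrix.toEuclideanLin Uᵀ x‖ ^ 2 + ‖Matrix.toEuclideanLin (1 - U * Uᵀ) x‖ ^ 2 := by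
  have h1 : inner ℝ x (Matrix.toEuclideanLin U (Matrix.toEuclideanLin Uᵀ x)) =
      ‖Matrix.toEuclideanLin Uᵀ x‖ ^ 2 := by
    rw [real_inner_comm, inner_toEuclideanLin_transpose, real_inner_self_eq_norm_sq]
  rw [map_sub, LinearMap.sub_apply, toEuclideanLin_one_apply, toEuclideanLin_mul_apply,
    norm_sub_sq_real, hU.norm_apply, h1]
  ring

theorem OrthonormalCols.specNorm_compl_le_one {U : Matrix (Fin p) (Fin r) ℝ}
    (hU : OrthonormalCols U) : specNorm (1 - U * Uᵀ) ≤ 1 := by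
  refine specNorm_le zero_le_one fun x => ?_
  rw [one_mul]
  refine le_of_sq_le_sq ?_ (norm_nonneg _)
  rw [hU.norm_sq_split x]
  nlinarith [sq_nonneg ‖Matrix.toEuclideanLin Uᵀ x‖]

theorem OrthonormalCols.compl_mul {U : Matrix (Fin p) (Fin r) ℝ} (hU : OrthonormalCols U) :
    (1 - U * Uᵀ) * U = 0 := by
  rw [Matrix.sub_mul, Matrix.mul_assoc, hU, Matrix.one_mul, Matrix.mul_one, sub_self]

theorem transpose_compl (U : Matrix (Fin p) (Fin r) ℝ) : (1 - U * Uᵀ)ᵀ = 1 - U * Uᵀ := by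
  simp

theorem OrthonormalCols.transpose_mul_compl {U : Matrix (Fin p) (Fin r) ℝ}
    (hU : OrthonormalCols U) : Uᵀ * (1 - U * Uᵀ) = 0 := by
  rw [← transpose_compl, ← Matrix.transpose_mul, hU.compl_mul, Matrix.transpose_zero]

/-! ### Matrices bounded below -/

/-- `‖M x‖ ≥ c ‖x‖` for all `x`. -/
def BoundedBelow (c : ℝ) (M : Matrix (Fin p) (Fin q) ℝ) : Prop :=
  ∀ x : EuclideanSpace ℝ (Fin q), c * ‖x‖ ≤ ‖Matrix.toEuclideanLin M x‖

namespace BoundedBelow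

theorem mono {c d : ℝ} {M : Matrix (Fin p) (Fin q) ℝ} (h : BoundedBelow c M) (hd : d ≤ c) :
    BoundedBelow d M :=
  fun x => (mul_le_mul_of_nonneg_right hd (norm_nonneg x)).trans (h x)

theorem isUnit_det {c : ℝ} {M : Matrix (Fin r) (Fin r) ℝ} (h : BoundedBelow c M) (hc : 0 < c) :
    IsUnit M.det := by
  rw [← Matrix.isUnit_iff_isUnit_det, ← Matrix.mulVec_injective_iff_isUnit,
    ← Matrix.coe_mulVecLin, ← LinearMap.ker_eq_bot, LinearMap.ker_eq_bot']
  intro v hv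
  have h1 := h (WithLp.toLp 2 v)
  have h2 : Matrix.toEuclideanLin M (WithLp.toLp 2 v) = 0 := by
    rw [Matrix.toLpLin_toLp]; exact congrArg (WithLp.toLp 2) hv
  rw [h2, norm_zero] at h1
  have h3 : ‖WithLp.toLp 2 v‖ ≤ 0 := nonpos_of_mul_nonpos_right h1 hc
  simpa using h3

theorem specNorm_inv_le {c : ℝ} {M : Matrix (Fin r) (Fin r) ℝ} (h : BoundedBelow c M)
    (hc : 0 < c) : specNorm M⁻¹ ≤ c⁻¹ := by
  refine specNorm_le (inv_nonneg.2 hc.le) fun x => ?_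
  have h1 := h (Matrix.toEuclideanLin M⁻¹ x)
  rw [← toEuclideanLin_mul_apply, Matrix.mul_nonsing_inv _ (h.isUnit_det hc),
    toEuclideanLin_one_apply] at h1
  rwa [inv_mul_eq_div, le_div_iff₀' hc]

theorem of_specNorm_inv_le {c : ℝ} {M : Matrix (Fin r) (Fin r) ℝ} (hM : IsUnit M.det)
    (hc : 0 < c) (h : specNorm M⁻¹ ≤ c⁻¹) : BoundedBelow c M := fun x => by
  have h1 := norm_toEuclideanLin_le M⁻¹ (Matrix.toEuclideanLin M x)
  rw [← toEuclideanLin_mul_apply, Matrix.nonsing_inv_mul _ hM, toEuclideanLin_one_apply] at h1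
  have h2 := h1.trans (mul_le_mul_of_nonneg_right h (norm_nonneg _))
  rwa [inv_mul_eq_div, le_div_iff₀' hc] at h2

/-- For a square matrix and `c > 0` the lower bound is equivalent to `‖M⁻¹‖ ≤ c⁻¹`, a condition
invariant under transposition. -/
theorem transpose {c : ℝ} {M : Matrix (Fin r) (Fin r) ℝ} (h : BoundedBelow c M) (hc : 0 < c) :
    BoundedBelow c Mᵀ := by
  refine of_specNorm_inv_le ?_ hc ?_
  · rw [Matrix.det_transpose]; exact h.isUnit_det hc
  · rw [← Matrix.transpose_nonsing_inv, specNorm_transpose]; exact h.specNorm_inv_le hc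

theorem mul {c d : ℝ} {M : Matrix (Fin p) (Fin m) ℝ} {N : Matrix (Fin m) (Fin q) ℝ}
    (hM : BoundedBelow c M) (hN : BoundedBelow d N) (hc : 0 ≤ c) : BoundedBelow (c * d) (M * N) :=
  fun x => by
    rw [toEuclideanLin_mul_apply, mul_assoc]
    exact (mul_le_mul_of_nonneg_left (hN x) hc).trans (hM _)

theorem add {c d : ℝ} {M N : Matrix (Fin p) (Fin q) ℝ} (hM : BoundedBelow c M)
    (hN : specNorm N ≤ d) : BoundedBelow (c - d) (M + N) := fun x => by
  have h1 := hM x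
  have h2 := (norm_toEuclideanLin_le N x).trans (mul_le_mul_of_nonneg_right hN (norm_nonneg x))
  have h3 := norm_sub_norm_le (Matrix.toEuclideanLin M x) (-Matrix.toEuclideanLin N x)
  rw [norm_neg, sub_neg_eq_add] at h3
  rw [map_add, LinearMap.add_apply]
  linarith

theorem diagonal {c : ℝ} {s : Fin r → ℝ} (hc : 0 ≤ c) (hs : ∀ i, c ≤ s i) :
    BoundedBelow c (Matrix.diagonal s) := fun x => by
  refine le_of_sq_le_sq ?_ (norm_nonneg _)
  rw [mul_pow, EuclideanSpace.norm_sq_eq, EuclideanSpace.norm_sq_eq, Finset.mul_sum]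
  refine Finset.sum_le_sum fun i _ => ?_
  simp only [Matrix.toLpLin_apply, Matrix.mulVec_diagonal, norm_mul, mul_pow]
  refine mul_le_mul_of_nonneg_right ?_ (sq_nonneg _)
  rw [Real.norm_eq_abs, sq_abs]
  exact pow_le_pow_left₀ hc (hs i) 2

end BoundedBelow

theorem IsMoorePenrose.eq_inv {M P : Matrix (Fin r) (Fin r) ℝ} (h : IsMoorePenrose M P)
    (hM : IsUnit M.det) : P = M⁻¹ := by
  have h1 : M⁻¹ * (M * P * M) * M⁻¹ = M⁻¹ * M * M⁻¹ := by rw [h.1]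
  rwa [Matrix.mul_assoc M, Matrix.nonsing_inv_mul_cancel_left _ _ hM,
    Matrix.mul_nonsing_inv_cancel_right _ _ hM, Matrix.nonsing_inv_mul _ hM, Matrix.one_mul] at h1

/-! ### Two subspaces of equal dimension -/

/-- From sines to cosines: Pythagoras splits `W x`, of length `‖x‖`, into its part in the column
space of `U` and its part orthogonal to it. -/
theorem OrthonormalCols.boundedBelow_transpose_mul {U W : Matrix (Fin p) (Fin r) ℝ}
    (hU : OrthonormalCols U) (hW : OrthonormalCols W) {s : ℝ}
    (h : specNorm ((1 - U * Uᵀ) * W) ≤ s) : BoundedBelow √(1 - s ^ 2) (Uᵀ * W) := fun x => by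
  have h1 := hU.norm_sq_split (Matrix.toEuclideanLin W x)
  rw [hW.norm_apply, ← toEuclideanLin_mul_apply, ← toEuclideanLin_mul_apply] at h1
  have h2 := pow_le_pow_left₀ (norm_nonneg _) ((norm_toEuclideanLin_le _ x).trans
    (mul_le_mul_of_nonneg_right h (norm_nonneg x))) 2
  -- For `s ≥ 1` the square root takes its default value `0` and nothing is claimed.
  rcases le_total (1 - s ^ 2) 0 with h0 | h0
  · rw [Real.sqrt_eq_zero_of_nonpos h0, zero_mul]; exact norm_nonneg _
  · refine le_of_sq_le_sq ?_ (norm_nonneg _)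
    rw [mul_pow, Real.sq_sqrt h0]
    linarith

/-- The largest principal angle is symmetric in the two subspaces because their dimensions agree:
`Uᵀ W` is square, so its lower bound, positive as `s < 1`, passes to `Wᵀ U`. -/
theorem OrthonormalCols.specNorm_compl_mul_comm {U W : Matrix (Fin p) (Fin r) ℝ}
    (hU : OrthonormalCols U) (hW : OrthonormalCols W) {s : ℝ} (hs : s < 1)
    (h : specNorm ((1 - U * Uᵀ) * W) ≤ s) : specNorm ((1 - W * Wᵀ) * U) ≤ s := by
  have hs0 : 0 ≤ s := (specNorm_nonneg _).trans h
  have h0 : 0 < 1 - s ^ 2 := by nlinarith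
  have hb := (hU.boundedBelow_transpose_mul hW h).transpose (Real.sqrt_pos.2 h0)
  rw [Matrix.transpose_mul, Matrix.transpose_transpose] at hb
  refine specNorm_le hs0 fun x => ?_
  have h1 := hW.norm_sq_split (Matrix.toEuclideanLin U x)
  rw [hU.norm_apply, ← toEuclideanLin_mul_apply, ← toEuclideanLin_mul_apply] at h1
  have h2 := pow_le_pow_left₀ (by positivity) (hb x) 2
  rw [mul_pow, Real.sq_sqrt h0.le] at h2
  refine le_of_sq_le_sq ?_ (by positivity)
  rw [mul_pow]
  linarith

/-! ### Singular values -/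

/-- The rank of `X` is at most the number of nonzero `s j`, so none of the `r` values can vanish. -/
theorem IsSVD.ne_zero {X : Matrix (Fin p) (Fin q) ℝ} {U : Matrix (Fin p) (Fin r) ℝ}
    {s : Fin r → ℝ} {V : Matrix (Fin q) (Fin r) ℝ} (h : IsSVD X U s V) (hX : X.rank = r)
    (i : Fin r) : s i ≠ 0 := by
  obtain ⟨-, -, -, rfl⟩ := h
  have h1 : r ≤ Fintype.card {j // s j ≠ 0} := by
    rw [← Matrix.rank_diagonal]
    exact hX.ge.trans ((Matrix.rank_mul_le_left _ _).trans (Matrix.rank_mul_le_right _ _))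
  intro hi
  have h2 : Fintype.card {j // s j ≠ 0} < Fintype.card (Fin r) :=
    Fintype.card_subtype_lt (x := i) (by simpa using hi)
  rw [Fintype.card_fin] at h2
  omega

theorem finrank_range_toEuclideanLin (X : Matrix (Fin p) (Fin q) ℝ) :
    Module.finrank ℝ (Matrix.toEuclideanLin X).range = X.rank := by
  have h : Matrix.toEuclideanLin X = Matrix.toLin (PiLp.basisFun 2 ℝ _) (PiLp.basisFun 2 ℝ _) X :=
    congrArg (fun e => e X) (Matrix.toLpLin_eq_toLin 2 2)
  rw [h]
  exact (Matrix.rank_eq_finrank_range_toLin X _ _).symm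

theorem sigma_pos {X : Matrix (Fin p) (Fin q) ℝ} (hr : 1 ≤ r) (hX : X.rank = r) :
    0 < sigma r X := by
  rw [sigma, LinearMap.singularValues_pos_iff_lt_finrank_range, finrank_range_toEuclideanLin]
  omega

/-- Links the entries of an arbitrary, unordered decomposition to the ordered singular values: `V
e_i` is an eigenvector of `Xᵀ X` with eigenvalue `s i ^ 2`, so `s i` occurs among the singular
values. -/
theorem IsSVD.sigma_le {X : Matrix (Fin p) (Fin q) ℝ} {U : Matrix (Fin p) (Fin r) ℝ}
    {s : Fin r → ℝ} {V : Matrix (Fin q) (Fin r) ℝ} (h : IsSVD X U s V) (hX : X.rank = r)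
    (i : Fin r) : sigma r X ≤ s i := by
  have hne := h.ne_zero hX i
  obtain ⟨hU, hV, hs, hXe⟩ := h
  set T := Matrix.toEuclideanLin X with hT
  set e : EuclideanSpace ℝ (Fin r) := EuclideanSpace.single i 1 with he
  have hadj : T.adjoint = Matrix.toEuclideanLin Xᵀ := by
    rw [hT, ← Matrix.toEuclideanLin_conjTranspose_eq_adjoint,
      Matrix.conjTranspose_eq_transpose_of_trivial]
  have hdiag : ∀ c : ℝ, Matrix.toEuclideanLin (Matrix.diagonal s) (c • e) = (s i * c) • e := by
    intro c
    ext j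
    by_cases hj : j = i
    · subst hj; simp [he, Matrix.toLpLin_apply, mul_comm]
    · simp [he, Matrix.toLpLin_apply, hj]
  have hprod : Xᵀ * X * V = V * (Matrix.diagonal s * Matrix.diagonal s) := by
    have hVV : Vᵀ * V = 1 := hV
    have hUU : Uᵀ * U = 1 := hU
    rw [hXe, Matrix.transpose_mul, Matrix.transpose_mul, Matrix.transpose_transpose,
      Matrix.diagonal_transpose]
    calc V * (Matrix.diagonal s * Uᵀ) * (U * Matrix.diagonal s * Vᵀ) * V
        = V * (Matrix.diagonal s * (Uᵀ * U) * Matrix.diagonal s * (Vᵀ * V)) := by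
          simp only [Matrix.mul_assoc]
      _ = _ := by rw [hUU, hVV, Matrix.mul_one, Matrix.mul_one]
  have hev : Module.End.HasEigenvalue (T.adjoint ∘ₗ T) (s i ^ 2) := by
    refine Module.End.hasEigenvalue_of_hasEigenvector (x := Matrix.toEuclideanLin V e)
      ⟨Module.End.mem_eigenspace_iff.2 ?_, ?_⟩
    · rw [hadj, LinearMap.comp_apply, hT, ← toEuclideanLin_mul_apply, ← toEuclideanLin_mul_apply,
        hprod, toEuclideanLin_mul_apply, toEuclideanLin_mul_apply]
      have h1 := hdiag 1
      rw [one_smul, mul_one] at h1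
      rw [h1, hdiag, map_smul, sq]
    · rw [← norm_ne_zero_iff, hV.norm_apply]
      simp [he]
  obtain ⟨k, hk⟩ := T.isSymmetric_adjoint_comp_self.exists_eigenvalues_eq rfl hev
  have hk' : T.singularValues k ^ 2 = s i ^ 2 := by
    rw [LinearMap.sq_singularValues_fin T rfl k]; exact hk
  have hks : T.singularValues k = s i :=
    (sq_eq_sq₀ (T.singularValues_nonneg k) (hs i)).1 hk'
  -- A positive singular value has index `k < r` counting from `0`, so it is at least the one of
  -- index `r - 1`, which is `sigma r X`.
  have hpos : 0 < T.singularValues k := by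
    rw [hks]; exact lt_of_le_of_ne (hs i) hne.symm
  rw [LinearMap.singularValues_pos_iff_lt_finrank_range, hT, finrank_range_toEuclideanLin, hX]
    at hpos
  rw [← hks]
  exact T.singularValues_antitone (by omega)

/-! ### Restricted isometry constants -/

theorem rank_add_le (M N : Matrix (Fin p) (Fin q) ℝ) : (M + N).rank ≤ M.rank + N.rank := by
  have h := LinearMap.rank_add_le M.mulVecLin N.mulVecLin
  rw [← Matrix.mulVecLin_add] at h
  simp only [LinearMap.rank, ← Module.finrank_eq_rank] at h
  exact_mod_cast h

theorem rank_smul_le (c : ℝ) (M : Matrix (Fin p) (Fin q) ℝ) : (c • M).rank ≤ M.rank := by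
  have h := Matrix.rank_mul_le_right (c • (1 : Matrix (Fin p) (Fin p) ℝ)) M
  rwa [Matrix.smul_mul, Matrix.one_mul] at h

theorem ricConst_mono (A : Fin n → Matrix (Fin p) (Fin q) ℝ) (hp : 1 ≤ p) (hq : 1 ≤ q) {k l : ℕ}
    (hk : 1 ≤ k) (hkl : k ≤ l) : ricConst A k ≤ ricConst A l :=
  (isLeast_ricConst A k hp hq hk).2 fun Z hZ =>
    (isLeast_ricConst A l hp hq (hk.trans hkl)).1 Z (hZ.trans hkl)

/-- Near-isometries nearly preserve orthogonality, by polarization. -/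
theorem IsRestrictedIsometryBound.inner_le {A : Fin n → Matrix (Fin p) (Fin q) ℝ} {k : ℕ} {δ : ℝ}
    (h : IsRestrictedIsometryBound A k δ) {M N : Matrix (Fin p) (Fin q) ℝ}
    (hrank : M.rank + N.rank ≤ k) (hMN : frobInner M N = 0) :
    inner ℝ (measMap A M) (measMap A N) ≤ δ * frobNorm M * frobNorm N := by
  set a := frobNorm M with ha
  set b := frobNorm N with hb
  have hr : ∀ c d : ℝ, (c • M + d • N).rank ≤ k := fun c d =>
    (rank_add_le _ _).trans ((add_le_add (rank_smul_le c M) (rank_smul_le d N)).trans hrank)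
  have hf : ∀ c d : ℝ, frobNorm (c • M + d • N) ^ 2 = c ^ 2 * a ^ 2 + d ^ 2 * b ^ 2 := by
    intro c d
    have hNM : frobInner N M = 0 := by rw [frobInner_comm, hMN]
    rw [frobNorm_sq, frobInner_add_left, frobInner_add_right, frobInner_add_right]
    simp only [frobInner_smul_left, frobInner_smul_right, hMN, hNM, ← frobNorm_sq,
      frobNorm_smul_sq, ha, hb]
    ring
  have hm : ∀ c d : ℝ, ‖measMap A (c • M + d • N)‖ ^ 2 = c ^ 2 * ‖measMap A M‖ ^ 2 +
      2 * (c * d) * inner ℝ (measMap A M) (measMap A N) + d ^ 2 * ‖measMap A N‖ ^ 2 := by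
    intro c d
    rw [map_add, map_smul, map_smul, norm_add_sq_real, norm_smul, norm_smul, inner_smul_left,
      inner_smul_right, mul_pow, mul_pow, Real.norm_eq_abs, Real.norm_eq_abs, sq_abs, sq_abs]
    simp only [conj_trivial]
    ring
  -- The weights give `b M` and `a N` the same norm `a b`. Subtracting the lower bound at `b M - a
  -- N` from the upper bound at `b M + a N` leaves `4ab ⟨𝒜 M, 𝒜 N⟩ ≤ 4δ a² b²`; dividing by `ab`
  -- requires both matrices to be nonzero.
  have h1 := (h _ (hr b a)).2
  have h2 := (h _ (hr b (-a))).1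
  rw [hm, hf] at h1 h2
  rcases eq_or_ne M 0 with h0 | hM
  · have ha0 : a = 0 := by
      have : a ^ 2 = 0 := by rw [ha, frobNorm_sq, h0]; simp
      simpa using this
    rw [ha0, h0]; simp
  rcases eq_or_ne N 0 with h0 | hN
  · have hb0 : b = 0 := by
      have : b ^ 2 = 0 := by rw [hb, frobNorm_sq, h0]; simp
      simpa using this
    rw [hb0, h0]; simp
  have hab : 0 < a * b := mul_pos (frobNorm_pos hM) (frobNorm_pos hN)
  refine le_of_mul_le_mul_left ?_ hab
  nlinarith

/-! ### The least squares step -/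

/-- `Z` lies in the space of matrices `U L + R Vᵀ`. -/
def IsTangent (U : Matrix (Fin p) (Fin r) ℝ) (V : Matrix (Fin q) (Fin r) ℝ)
    (Z : Matrix (Fin p) (Fin q) ℝ) : Prop :=
  (1 - U * Uᵀ) * Z * (1 - V * Vᵀ) = 0

namespace IsTangent

variable {U : Matrix (Fin p) (Fin r) ℝ} {V : Matrix (Fin q) (Fin r) ℝ}
  {Z Z' : Matrix (Fin p) (Fin q) ℝ}

theorem add (h : IsTangent U V Z) (h' : IsTangent U V Z') : IsTangent U V (Z + Z') := by
  rw [IsTangent, Matrix.mul_add, Matrix.add_mul, h, h', add_zero]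

theorem smul (h : IsTangent U V Z) (c : ℝ) : IsTangent U V (c • Z) := by
  rw [IsTangent, Matrix.mul_smul, Matrix.smul_mul, h, smul_zero]

/-- Tangency says exactly that `(1 - U Uᵀ) Z` is unchanged by right multiplication with `V Vᵀ`. Each
summand factors through dimension `r`, which is the source of the rank bound `2r`. -/
theorem eq_add (h : IsTangent U V Z) :
    Z = U * (Uᵀ * Z) + (1 - U * Uᵀ) * Z * V * Vᵀ := by
  have h1 : (1 - U * Uᵀ) * Z = (1 - U * Uᵀ) * Z * V * Vᵀ := by
    rw [IsTangent, Matrix.mul_sub, Matrix.mul_one, sub_eq_zero, ← Matrix.mul_assoc] at h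
    exact h
  rw [← h1, Matrix.sub_mul, Matrix.one_mul, Matrix.mul_assoc]
  abel

theorem rank_le (h : IsTangent U V Z) : Z.rank ≤ 2 * r := by
  rw [h.eq_add]
  refine (rank_add_le _ _).trans ?_
  have h1 := (Matrix.rank_mul_le_left U (Uᵀ * Z)).trans U.rank_le_width
  have h2 := (Matrix.rank_mul_le_right ((1 - U * Uᵀ) * Z * V) Vᵀ).trans Vᵀ.rank_le_height
  omega

end IsTangent

theorem isTangent_mul_left {U : Matrix (Fin p) (Fin r) ℝ} (hU : OrthonormalCols U)
    (V : Matrix (Fin q) (Fin r) ℝ) (L : Matrix (Fin r) (Fin q) ℝ) : IsTangent U V (U * L) := by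
  rw [IsTangent, ← Matrix.mul_assoc, hU.compl_mul, Matrix.zero_mul, Matrix.zero_mul]

theorem isTangent_mul_right {V : Matrix (Fin q) (Fin r) ℝ} (hV : OrthonormalCols V)
    (U : Matrix (Fin p) (Fin r) ℝ) (L : Matrix (Fin p) (Fin r) ℝ) : IsTangent U V (L * Vᵀ) := by
  rw [IsTangent, Matrix.mul_assoc, Matrix.mul_assoc, hV.transpose_mul_compl, Matrix.mul_zero,
    Matrix.mul_zero]

/-- The block matrix `[U W]` is square and has its transpose as left inverse, hence also as right
inverse. The truncated difference `p - r` is the true one because `r ≤ p`. -/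
theorem IsOrthoComplement.mul_transpose {U : Matrix (Fin p) (Fin r) ℝ}
    {W : Matrix (Fin p) (Fin (p - r)) ℝ} (hU : OrthonormalCols U) (h : IsOrthoComplement U W)
    (hr : r ≤ p) : W * Wᵀ = 1 - U * Uᵀ := by
  have h' : Wᵀ * U = 0 := by
    rw [← Matrix.transpose_transpose (Wᵀ * U), Matrix.transpose_mul, Matrix.transpose_transpose,
      h.2, Matrix.transpose_zero]
  have h1 : Matrix.fromRows Uᵀ Wᵀ * Matrix.fromCols U W = 1 := by
    rw [Matrix.fromRows_mul_fromCols, hU, h.1, h.2, h', Matrix.fromBlocks_one]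
  have e : Fin r ⊕ Fin (p - r) ≃ Fin p := finSumFinEquiv.trans (finCongr (by omega))
  have h2 := (Matrix.mul_eq_one_comm_of_equiv e).1 h1
  rw [Matrix.fromCols_mul_fromRows] at h2
  rw [← h2, add_sub_cancel_left]

theorem measMap_sandwich (A : Fin n → Matrix (Fin p) (Fin q) ℝ) {a b : ℕ}
    (L : Matrix (Fin p) (Fin a) ℝ) (R : Matrix (Fin q) (Fin b) ℝ) (Z : Matrix (Fin a) (Fin b) ℝ) :
    measMap (fun i => Lᵀ * A i * R) Z = measMap A (L * Z * Rᵀ) := by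
  ext i
  change frobInner (Lᵀ * A i * R) Z = frobInner (A i) (L * Z * Rᵀ)
  rw [frobInner_mul_right, frobInner_mul_left, Matrix.transpose_transpose, Matrix.mul_assoc]

theorem sketchedLoss_eq (A : Fin n → Matrix (Fin p) (Fin q) ℝ) (y : EuclideanSpace ℝ (Fin n))
    (U : Matrix (Fin p) (Fin r) ℝ) (Up : Matrix (Fin p) (Fin (p - r)) ℝ)
    (V : Matrix (Fin q) (Fin r) ℝ) (Vp : Matrix (Fin q) (Fin (q - r)) ℝ)
    (B : Matrix (Fin r) (Fin r) ℝ) (D₁ : Matrix (Fin (p - r)) (Fin r) ℝ)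
    (D₂ : Matrix (Fin (q - r)) (Fin r) ℝ) :
    sketchedLoss A y U Up V Vp B D₁ D₂ =
      ‖y - measMap A (U * B * Vᵀ + Up * D₁ * Vᵀ + U * D₂ᵀ * Vpᵀ)‖ ^ 2 := by
  rw [sketchedLoss, measMap_sandwich, measMap_sandwich, measMap_sandwich, map_add, map_add]
  congr 2
  abel

theorem inner_eq_zero_of_norm_sub_smul {E : Type*} [NormedAddCommGroup E] [InnerProductSpace ℝ E]
    {e v : E} (h : ∀ t : ℝ, ‖e‖ ^ 2 ≤ ‖e - t • v‖ ^ 2) : inner ℝ e v = 0 := by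
  rcases eq_or_ne v 0 with rfl | hv
  · simp
  have hv' : 0 < ‖v‖ ^ 2 := by positivity
  -- This `t` minimizes the quadratic `‖e - t v‖²`.
  have h1 := h (inner ℝ e v / ‖v‖ ^ 2)
  rw [norm_sub_sq_real, inner_smul_right, norm_smul, mul_pow, Real.norm_eq_abs, sq_abs] at h1
  have h2 : (inner ℝ e v / ‖v‖ ^ 2) ^ 2 * ‖v‖ ^ 2 = inner ℝ e v ^ 2 / ‖v‖ ^ 2 := by
    field_simp
  have h3 : inner ℝ e v / ‖v‖ ^ 2 * inner ℝ e v = inner ℝ e v ^ 2 / ‖v‖ ^ 2 := by ring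
  rw [h2, h3] at h1
  have h4 : inner ℝ e v ^ 2 / ‖v‖ ^ 2 ≤ 0 := by linarith
  rw [div_le_iff₀ hv', zero_mul] at h4
  exact pow_eq_zero_iff two_ne_zero |>.1 (le_antisymm h4 (sq_nonneg _))

theorem IsQR.orthonormalCols_and_mul {X Q : Matrix (Fin p) (Fin r) ℝ} (h : IsQR X Q) :
    OrthonormalCols Q ∧ Q * Qᵀ * X = X := by
  obtain ⟨hQ, R, -, rfl⟩ := h
  refine ⟨hQ, ?_⟩
  rw [Matrix.mul_assoc, ← Matrix.mul_assoc Qᵀ, hQ, Matrix.one_mul]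

/-- Coordinate-free description of a RISRO step: `Z` is the least squares solution on the tangent
space and `X' = Z V (Uᵀ Z V)† Uᵀ Z`. -/
theorem IsRisroStep.exists_tangent {A : Fin n → Matrix (Fin p) (Fin q) ℝ}
    {y : EuclideanSpace ℝ (Fin n)} {U U' : Matrix (Fin p) (Fin r) ℝ}
    {V V' : Matrix (Fin q) (Fin r) ℝ} {X' : Matrix (Fin p) (Fin q) ℝ}
    (h : IsRisroStep A y U V U' V' X') (hU : OrthonormalCols U) (hV : OrthonormalCols V)
    (hp : r ≤ p) (hq : r ≤ q) :
    (OrthonormalCols U' ∧ OrthonormalCols V' ∧ U' * U'ᵀ * X' = X' ∧ X' * (V' * V'ᵀ) = X') ∧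
    ∃ Z : Matrix (Fin p) (Fin q) ℝ, IsTangent U V Z ∧
      (∀ H, IsTangent U V H → inner ℝ (y - measMap A Z) (measMap A H) = 0) ∧
      ∃ P, IsMoorePenrose (Uᵀ * Z * V) P ∧ X' = Z * V * P * (Uᵀ * Z) := by
  obtain ⟨Up, Vp, B, P, D₁, D₂, XU, XV, hUp, hVp, hmin, hXU, hXV, hQU, hQV, hP, hX'⟩ := h
  obtain ⟨hU', hU'X⟩ := hQU.orthonormalCols_and_mul
  obtain ⟨hV', hV'X⟩ := hQV.orthonormalCols_and_mul
  have hUU : Uᵀ * U = 1 := hU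
  have hVV : Vᵀ * V = 1 := hV
  have hVpV : Vpᵀ * V = 0 := by
    rw [← Matrix.transpose_transpose (Vpᵀ * V), Matrix.transpose_mul, Matrix.transpose_transpose,
      hVp.2, Matrix.transpose_zero]
  set Z := U * B * Vᵀ + Up * D₁ * Vᵀ + U * D₂ᵀ * Vpᵀ with hZ
  have hZt : IsTangent U V Z := by
    rw [hZ, Matrix.mul_assoc U, Matrix.mul_assoc U]
    exact ((isTangent_mul_left hU V _).add (isTangent_mul_right hV U _)).add
      (isTangent_mul_left hU V _)
  have hZV : Z * V = XU := by
    rw [hZ, hXU, Matrix.add_mul, Matrix.add_mul, Matrix.mul_assoc _ Vᵀ, Matrix.mul_assoc _ Vᵀ,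
      Matrix.mul_assoc _ Vpᵀ, hVV, hVpV, Matrix.mul_zero, add_zero, Matrix.mul_one, Matrix.mul_one]
  have hUZ : Uᵀ * Z = XVᵀ := by
    rw [hZ, hXV, Matrix.mul_add, Matrix.mul_add, Matrix.transpose_add, Matrix.transpose_mul,
      Matrix.transpose_mul, Matrix.transpose_transpose]
    simp only [Matrix.mul_assoc]
    rw [← Matrix.mul_assoc Uᵀ U, ← Matrix.mul_assoc Uᵀ U, ← Matrix.mul_assoc Uᵀ Up, hUU, hUp.2]
    simp
  have hB : Uᵀ * Z * V = B := by
    rw [hUZ, hXV, Matrix.transpose_add, Matrix.transpose_mul, Matrix.transpose_mul,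
      Matrix.transpose_transpose, Matrix.add_mul, Matrix.mul_assoc, Matrix.mul_assoc, hVV, hVpV]
    simp
  refine ⟨⟨hU', hV', ?_, ?_⟩, Z, hZt, ?_, P, ?_, ?_⟩
  · rw [hX', ← Matrix.mul_assoc, ← Matrix.mul_assoc, hU'X]
  · have h1 : XVᵀ * (V' * V'ᵀ) = XVᵀ := by
      rw [← Matrix.transpose_inj, Matrix.transpose_mul, Matrix.transpose_mul]
      simpa using hV'X
    rw [hX', Matrix.mul_assoc, h1]
  · intro H hH
    refine inner_eq_zero_of_norm_sub_smul fun t => ?_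
    have hK : IsTangent U V (Z + t • H) := hZt.add (hH.smul t)
    set K := Z + t • H with hKdef
    -- Every tangent matrix is attained by suitable parameters, so minimality over `(B, D₁, D₂)` is
    -- minimality over the whole tangent space.
    have hKe : U * (Uᵀ * K * V) * Vᵀ + Up * (Upᵀ * K * V) * Vᵀ + U * (Vpᵀ * Kᵀ * U)ᵀ * Vpᵀ = K := by
      have e1 : U * (Vpᵀ * Kᵀ * U)ᵀ * Vpᵀ = U * Uᵀ * K * (Vp * Vpᵀ) := by
        simp only [Matrix.transpose_mul, Matrix.transpose_transpose, Matrix.mul_assoc]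
      have e2 : Up * (Upᵀ * K * V) * Vᵀ = Up * Upᵀ * K * V * Vᵀ := by
        simp only [Matrix.mul_assoc]
      rw [e1, e2, hUp.mul_transpose hU hp, hVp.mul_transpose hV hq]
      conv_rhs => rw [hK.eq_add]
      simp only [Matrix.mul_sub, Matrix.mul_one, Matrix.mul_assoc]
      abel
    have h1 := hmin (Uᵀ * K * V) (Upᵀ * K * V) (Vpᵀ * Kᵀ * U)
    rw [sketchedLoss_eq, sketchedLoss_eq, hKe, ← hZ, hKdef, (measMap A).map_add Z,
      (measMap A).map_smul, ← sub_sub] at h1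
    exact h1
  · rwa [hB]
  · rw [hZV, hUZ, hX']

/-! ### Perturbation of singular subspaces -/

section Perturbation

variable {U Ub : Matrix (Fin p) (Fin r) ℝ} {V Vb : Matrix (Fin q) (Fin r) ℝ} {s : Fin r → ℝ}
  {X Xb : Matrix (Fin p) (Fin q) ℝ} {c : ℝ}

theorem IsSVD.transpose (h : IsSVD Xb Ub s Vb) : IsSVD Xbᵀ Vb s Ub := by
  obtain ⟨hU, hV, hs, hX⟩ := h
  refine ⟨hV, hU, hs, ?_⟩
  rw [hX, Matrix.transpose_mul, Matrix.transpose_mul, Matrix.transpose_transpose,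
    Matrix.diagonal_transpose, Matrix.mul_assoc]

theorem IsSVD.left_eq (h : IsSVD Xb Ub s Vb) (hc : 0 < c) (hs : ∀ i, c ≤ s i) :
    Ub = Xb * Vb * (Matrix.diagonal s)⁻¹ := by
  obtain ⟨-, hV, -, hX⟩ := h
  have hVV : Vbᵀ * Vb = 1 := hV
  rw [hX, Matrix.mul_assoc _ Vbᵀ, hVV, Matrix.mul_one,
    Matrix.mul_nonsing_inv_cancel_right _ _ ((BoundedBelow.diagonal hc.le hs).isUnit_det hc)]

theorem IsSVD.projection_mul (h : IsSVD Xb Ub s Vb) : Ub * Ubᵀ * Xb = Xb := by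
  obtain ⟨hU, -, -, hX⟩ := h
  have hUU : Ubᵀ * Ub = 1 := hU
  rw [hX, Matrix.mul_assoc Ub, Matrix.mul_assoc Ub (Matrix.diagonal s), ← Matrix.mul_assoc Ubᵀ,
    hUU, Matrix.one_mul]

/-- The projection annihilates `X`, so on `Xb` it sees only the error `X - Xb`. -/
theorem compl_mul_eq (hX : U * Uᵀ * X = X) (Xb : Matrix (Fin p) (Fin q) ℝ) :
    (1 - U * Uᵀ) * Xb = -((1 - U * Uᵀ) * (X - Xb)) := by
  rw [Matrix.mul_sub, Matrix.sub_mul 1 _ X, Matrix.one_mul, hX, sub_self, zero_sub, neg_neg]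

theorem mul_compl_eq (hX : X * (V * Vᵀ) = X) (Xb : Matrix (Fin p) (Fin q) ℝ) :
    Xb * (1 - V * Vᵀ) = -((X - Xb) * (1 - V * Vᵀ)) := by
  rw [Matrix.sub_mul, Matrix.mul_sub X, Matrix.mul_one, hX, sub_self, zero_sub, neg_neg]

/-- Wedin's `sin Θ` bound. -/
theorem IsSVD.specNorm_compl_mul_le (h : IsSVD Xb Ub s Vb) (hc : 0 < c) (hs : ∀ i, c ≤ s i)
    (hU : OrthonormalCols U) (hX : U * Uᵀ * X = X) :
    specNorm ((1 - U * Uᵀ) * Ub) ≤ specNorm (X - Xb) / c := by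
  rw [h.left_eq hc hs, ← Matrix.mul_assoc, ← Matrix.mul_assoc, compl_mul_eq hX, Matrix.neg_mul,
    Matrix.neg_mul, specNorm_neg, div_eq_mul_inv]
  refine specNorm_mul_le_of_le ?_ ((BoundedBelow.diagonal hc.le hs).specNorm_inv_le hc)
  have h1 := specNorm_mul_le_of_le (specNorm_mul_le_of_le hU.specNorm_compl_le_one
    (le_refl (specNorm (X - Xb)))) h.2.1.specNorm_le_one
  rwa [one_mul, mul_one] at h1

/-- The normal part is of second order: inserting `Ub Ubᵀ` next to `Xb` leaves a sine on the left
and the error `X - Xb` on the right. -/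
theorem IsSVD.frobNorm_normal_le (h : IsSVD Xb Ub s Vb) (hc : 0 < c) (hs : ∀ i, c ≤ s i)
    (hU : OrthonormalCols U) (hV : OrthonormalCols V) (hXU : U * Uᵀ * X = X)
    (hXV : X * (V * Vᵀ) = X) :
    frobNorm ((1 - U * Uᵀ) * Xb * (1 - V * Vᵀ)) ≤
      specNorm (X - Xb) / c * frobNorm (X - Xb) := by
  have e : (1 - U * Uᵀ) * Xb * (1 - V * Vᵀ) =
      (1 - U * Uᵀ) * Ub * (Ubᵀ * -((X - Xb) * (1 - V * Vᵀ))) := by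
    rw [← mul_compl_eq hXV, Matrix.mul_assoc _ Ub, ← Matrix.mul_assoc Ub, ← Matrix.mul_assoc _ Xb,
      h.projection_mul, Matrix.mul_assoc]
  rw [e]
  refine frobNorm_mul_le_left_of_le (h.specNorm_compl_mul_le hc hs hU hXU) ?_
  rw [Matrix.mul_neg, frobNorm_neg]
  have h1 := frobNorm_mul_le_left_of_le h.1.specNorm_transpose_le_one
    (frobNorm_mul_le_right_of_le (le_refl (frobNorm (X - Xb))) hV.specNorm_compl_le_one)
  rwa [mul_one, one_mul] at h1

/-- As `Ubᵀ G = 0`, only the part of `U` orthogonal to `Ub` meets `G`, and its size is the sine of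
the angle between the two spaces. -/
theorem IsSVD.frobNorm_transpose_mul_le (h : IsSVD Xb Ub s Vb) (hc : 0 < c)
    (hs : ∀ i, c ≤ s i) (hU : OrthonormalCols U) (hX : U * Uᵀ * X = X)
    (he : specNorm (X - Xb) < c) {G : Matrix (Fin p) (Fin q) ℝ} (hG : Ubᵀ * G = 0) :
    frobNorm (Uᵀ * G) ≤ specNorm (X - Xb) / c * frobNorm G := by
  have e : Uᵀ * G = ((1 - Ub * Ubᵀ) * U)ᵀ * G := by
    rw [Matrix.transpose_mul, transpose_compl, Matrix.mul_assoc, Matrix.sub_mul, Matrix.mul_assoc,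
      hG, Matrix.mul_zero, sub_zero, Matrix.one_mul]
  rw [e]
  refine frobNorm_mul_le_left_of_le ?_ le_rfl
  rw [specNorm_transpose]
  exact hU.specNorm_compl_mul_comm h.1 ((div_lt_one hc).2 he) (h.specNorm_compl_mul_le hc hs hU hX)

/-- The factor `2` counts the two summands of `IsTangent.eq_add`: one pairs with `Uᵀ G`, the other
with `G V`, and each of these carries a sine. -/
theorem IsSVD.frobInner_tangent_le (h : IsSVD Xb Ub s Vb) (hc : 0 < c) (hs : ∀ i, c ≤ s i)
    (hU : OrthonormalCols U) (hV : OrthonormalCols V) (hXU : U * Uᵀ * X = X)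
    (hXV : X * (V * Vᵀ) = X) (he : specNorm (X - Xb) < c) {G D : Matrix (Fin p) (Fin q) ℝ}
    (hGU : Ubᵀ * G = 0) (hGV : G * Vb = 0) (hD : IsTangent U V D) :
    frobInner D G ≤ 2 * (specNorm (X - Xb) / c) * frobNorm D * frobNorm G := by
  have h1 := h.frobNorm_transpose_mul_le hc hs hU hXU he hGU
  have e : specNorm (Xᵀ - Xbᵀ) = specNorm (X - Xb) := by
    rw [← Matrix.transpose_sub, specNorm_transpose]
  have hXV' : V * Vᵀ * Xᵀ = Xᵀ := by
    rw [← Matrix.transpose_inj]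
    simpa using hXV
  have h2 := h.transpose.frobNorm_transpose_mul_le hc hs hV hXV' (by rwa [e]) (G := Gᵀ)
    (by rw [← Matrix.transpose_mul, hGV, Matrix.transpose_zero])
  rw [e, ← Matrix.transpose_mul, frobNorm_transpose, frobNorm_transpose] at h2
  have e' : frobInner D G =
      frobInner (Uᵀ * D) (Uᵀ * G) + frobInner ((1 - U * Uᵀ) * D * V) (G * V) := by
    conv_lhs => rw [hD.eq_add]
    rw [frobInner_add_left, frobInner_mul_left, frobInner_mul_right _ Vᵀ,
      Matrix.transpose_transpose]
  rw [e']
  have h3 : frobInner (Uᵀ * D) (Uᵀ * G) ≤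
      frobNorm D * (specNorm (X - Xb) / c * frobNorm G) := by
    refine (frobInner_le _ _).trans (mul_le_mul ?_ h1 (frobNorm_nonneg _) (frobNorm_nonneg _))
    have := frobNorm_mul_le_left_of_le hU.specNorm_transpose_le_one (le_refl (frobNorm D))
    rwa [one_mul] at this
  have h4 : frobInner ((1 - U * Uᵀ) * D * V) (G * V) ≤
      frobNorm D * (specNorm (X - Xb) / c * frobNorm G) := by
    refine (frobInner_le _ _).trans (mul_le_mul ?_ h2 (frobNorm_nonneg _) (frobNorm_nonneg _))
    have := frobNorm_mul_le_right_of_le (frobNorm_mul_le_left_of_le hU.specNorm_compl_le_one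
      (le_refl (frobNorm D))) hV.specNorm_le_one
    rwa [one_mul, mul_one] at this
  linarith

theorem IsSVD.core_eq (h : IsSVD Xb Ub s Vb) (U : Matrix (Fin p) (Fin r) ℝ)
    (V : Matrix (Fin q) (Fin r) ℝ) :
    Uᵀ * Xb * V = Uᵀ * Ub * Matrix.diagonal s * (Vᵀ * Vb)ᵀ := by
  rw [h.2.2.2, Matrix.transpose_mul, Matrix.transpose_transpose]
  simp only [Matrix.mul_assoc]

/-- The core is `(Uᵀ Ub) diag(s) (Vᵀ Vb)ᵀ`. The outer factors are bounded below by the cosine `√(1 -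
(‖X - Xb‖ / c)²)`, so its square appears. All three factors are invertible, hence cancel in the
reconstruction of `Xb`. -/
theorem IsSVD.core_boundedBelow (h : IsSVD Xb Ub s Vb) (hc : 0 < c) (hs : ∀ i, c ≤ s i)
    (hU : OrthonormalCols U) (hV : OrthonormalCols V) (hXU : U * Uᵀ * X = X)
    (hXV : X * (V * Vᵀ) = X) (he : specNorm (X - Xb) < c) :
    BoundedBelow (c * (1 - (specNorm (X - Xb) / c) ^ 2)) (Uᵀ * Xb * V) ∧
      Xb = Xb * V * (Uᵀ * Xb * V)⁻¹ * (Uᵀ * Xb) := by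
  have hXV' : V * Vᵀ * Xᵀ = Xᵀ := by
    rw [← Matrix.transpose_inj]
    simpa using hXV
  have e : specNorm (Xᵀ - Xbᵀ) = specNorm (X - Xb) := by
    rw [← Matrix.transpose_sub, specNorm_transpose]
  have ht : specNorm (X - Xb) / c < 1 := (div_lt_one hc).2 he
  have ht0 : 0 ≤ specNorm (X - Xb) / c := div_nonneg (specNorm_nonneg _) hc.le
  have h0 : 0 < 1 - (specNorm (X - Xb) / c) ^ 2 := by nlinarith
  have h1 := hU.boundedBelow_transpose_mul h.1 (h.specNorm_compl_mul_le hc hs hU hXU)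
  have h2' := h.transpose.specNorm_compl_mul_le hc hs hV hXV'
  rw [e] at h2'
  have h2 := hV.boundedBelow_transpose_mul h.2.1 h2'
  have hr := Real.sqrt_pos.2 h0
  have hd : BoundedBelow c (Matrix.diagonal s) := BoundedBelow.diagonal hc.le hs
  have hu1 := h1.isUnit_det hr
  have hu2 := (h2.transpose hr).isUnit_det hr
  have hud := hd.isUnit_det hc
  constructor
  · rw [h.core_eq]
    refine ((h1.mul hd hr.le).mul (h2.transpose hr) (by positivity)).mono (le_of_eq ?_)
    rw [mul_right_comm, Real.mul_self_sqrt h0.le, mul_comm]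
  · have e1 : Xb * V = Ub * (Matrix.diagonal s * (Vᵀ * Vb)ᵀ) := by
      rw [h.2.2.2, Matrix.transpose_mul, Matrix.transpose_transpose]
      simp only [Matrix.mul_assoc]
    have e2 : Uᵀ * Xb = Uᵀ * Ub * (Matrix.diagonal s * Vbᵀ) := by
      rw [h.2.2.2]
      simp only [Matrix.mul_assoc]
    have hu3 : IsUnit (Matrix.diagonal s * (Vᵀ * Vb)ᵀ).det := by
      rw [Matrix.det_mul]; exact hud.mul hu2
    rw [h.core_eq, e1, e2, Matrix.mul_assoc (Uᵀ * Ub), Matrix.mul_inv_rev, ← Matrix.mul_assoc _ _⁻¹,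
      Matrix.mul_nonsing_inv_cancel_right _ _ hu3, Matrix.mul_assoc Ub,
      Matrix.nonsing_inv_mul_cancel_left _ _ hu1, ← Matrix.mul_assoc]
    exact h.2.2.2

end Perturbation

/-! ### Error of one step -/

section Step

variable {U Ub : Matrix (Fin p) (Fin r) ℝ} {V Vb : Matrix (Fin q) (Fin r) ℝ} {s : Fin r → ℝ}
  {X Xb Z : Matrix (Fin p) (Fin q) ℝ} {c : ℝ}

/-- Error of the least squares solution `Z` relative to the tangential part of `Xb`. -/
theorem frobNorm_tangent_error_le {A : Fin n → Matrix (Fin p) (Fin q) ℝ}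
    {y : EuclideanSpace ℝ (Fin n)} {a b : ℝ}
    (ha : IsRestrictedIsometryBound A (2 * r) a) (hb : IsRestrictedIsometryBound A (3 * r) b)
    (hb0 : 0 ≤ b)
    (h : IsSVD Xb Ub s Vb) (hc : 0 < c) (hs : ∀ i, c ≤ s i)
    (hU : OrthonormalCols U) (hV : OrthonormalCols V) (hXU : U * Uᵀ * X = X)
    (hXV : X * (V * Vᵀ) = X) (he : specNorm (X - Xb) < c)
    (hGU : Ubᵀ * measAdj A (y - measMap A Xb) = 0) (hGV : measAdj A (y - measMap A Xb) * Vb = 0)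
    (hZ : IsTangent U V Z)
    (hopt : ∀ H, IsTangent U V H → inner ℝ (y - measMap A Z) (measMap A H) = 0) :
    (1 - a) * frobNorm (Z - Xb + (1 - U * Uᵀ) * Xb * (1 - V * Vᵀ)) ≤
      specNorm (X - Xb) / c *
        (b * frobNorm (X - Xb) + 2 * frobNorm (measAdj A (y - measMap A Xb))) := by
  set W := (1 - U * Uᵀ) * Xb * (1 - V * Vᵀ) with hW
  set D := Z - Xb + W with hD
  set G := measAdj A (y - measMap A Xb) with hG
  have hPP : (1 - U * Uᵀ) * (1 - U * Uᵀ) = 1 - U * Uᵀ := by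
    rw [Matrix.mul_sub, Matrix.mul_one, ← Matrix.mul_assoc, hU.compl_mul, Matrix.zero_mul, sub_zero]
  have hQQ : (1 - V * Vᵀ) * (1 - V * Vᵀ) = 1 - V * Vᵀ := by
    rw [Matrix.mul_sub, Matrix.mul_one, ← Matrix.mul_assoc, hV.compl_mul, Matrix.zero_mul, sub_zero]
  have hPW : (1 - U * Uᵀ) * W * (1 - V * Vᵀ) = W := by
    rw [hW, Matrix.mul_assoc _ Xb, ← Matrix.mul_assoc, hPP, ← Matrix.mul_assoc, Matrix.mul_assoc,
      hQQ]
  have hDt : IsTangent U V D := by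
    have hZ' : (1 - U * Uᵀ) * Z * (1 - V * Vᵀ) = 0 := hZ
    rw [IsTangent, hD, Matrix.mul_add, Matrix.add_mul, hPW, Matrix.mul_sub _ Z Xb,
      Matrix.sub_mul (_ * Z), hZ',
      ← hW, zero_sub, neg_add_cancel]
  have hDW : frobInner D W = 0 := by
    have hDt' : (1 - U * Uᵀ) * D * (1 - V * Vᵀ) = 0 := hDt
    rw [frobInner_comm, hW, frobInner_mul_right, frobInner_mul_left, transpose_compl,
      transpose_compl, ← Matrix.mul_assoc, hDt', frobInner_zero_right]
  have hWr : W.rank ≤ r := by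
    rw [hW, h.2.2.2]
    refine (Matrix.rank_mul_le_left _ _).trans ((Matrix.rank_mul_le_right _ _).trans ?_)
    rw [Matrix.mul_assoc]
    exact (Matrix.rank_mul_le_left _ _).trans Ub.rank_le_width
  have hDr := hDt.rank_le
  -- Since `Z = Xb - W + D`, optimality tested on `D` balances `‖𝒜 D‖²` against `⟨𝒜 W, 𝒜 D⟩ + ⟨G,
  -- D⟩`.
  have h1 : y - measMap A Z = y - measMap A Xb + measMap A W - measMap A D := by
    rw [hD, map_add, map_sub]; abel
  have h2 := hopt D hDt
  rw [h1, inner_sub_left, inner_add_left, real_inner_self_eq_norm_sq,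
    real_inner_comm, inner_measMap, ← hG, real_inner_comm] at h2
  have h3 := hb.inner_le (M := D) (N := W) (by omega) hDW
  have h4 := h.frobInner_tangent_le hc hs hU hV hXU hXV he hGU hGV hDt
  have h5 := (ha D hDr).1
  have h6 := h.frobNorm_normal_le hc hs hU hV hXU hXV
  rw [← hW] at h6
  have hD0 := frobNorm_nonneg D
  have h7 : b * frobNorm D * frobNorm W ≤
      b * frobNorm D * (specNorm (X - Xb) / c * frobNorm (X - Xb)) :=
    mul_le_mul_of_nonneg_left h6 (by positivity)
  rcases hD0.eq_or_lt with h0 | h0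
  · rw [← h0, mul_zero]
    have := frobNorm_nonneg (X - Xb)
    have := frobNorm_nonneg G
    have := specNorm_nonneg (X - Xb)
    positivity
  · refine le_of_mul_le_mul_left ?_ h0
    linarith

/-- The error of the updated iterate in terms of the tangential error `D`. -/
theorem update_error_eq {D W : Matrix (Fin p) (Fin q) ℝ} {Bi Bbi : Matrix (Fin r) (Fin r) ℝ}
    (hU : OrthonormalCols U) (hV : OrthonormalCols V) (hZ : IsTangent U V Z)
    (hW : W = (1 - U * Uᵀ) * Xb * (1 - V * Vᵀ)) (hD : D = Z - Xb + W)
    (hBi : Bi * (Uᵀ * Z * V) = 1) (hBi' : Uᵀ * Z * V * Bi = 1)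
    (hBbi : Bbi * (Uᵀ * Xb * V) = 1)
    (hXb : Xb = Xb * V * Bbi * (Uᵀ * Xb)) :
    Z * V * Bi * (Uᵀ * Z) - Xb = D +
      (1 - U * Uᵀ) * D * V * (Bi * (Uᵀ * Z * (1 - V * Vᵀ)))
      - (1 - U * Uᵀ) * (Xb * V) * Bbi * (Uᵀ * D * V) * (Bi * (Uᵀ * Z * (1 - V * Vᵀ)))
      + (1 - U * Uᵀ) * (Xb * V) * Bbi * (Uᵀ * D * (1 - V * Vᵀ)) := by
  have hUD : Uᵀ * D = Uᵀ * Z - Uᵀ * Xb := by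
    rw [hD, hW, Matrix.mul_add, ← Matrix.mul_assoc, ← Matrix.mul_assoc, hU.transpose_mul_compl,
      Matrix.zero_mul, Matrix.zero_mul, add_zero, Matrix.mul_sub]
  have hDV : D * V = Z * V - Xb * V := by
    rw [hD, hW, Matrix.add_mul, Matrix.mul_assoc _ _ V, hV.compl_mul, Matrix.mul_zero, add_zero,
      Matrix.sub_mul]
  set Q := 1 - V * Vᵀ with hQ
  set P := 1 - U * Uᵀ with hP
  -- With `L` and `K` the update equals `Z + P Z V L`, while `W = K Uᵀ Xb Q`. Replacing `Z V` by `D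
  -- V + Xb V`, and `P Xb V` by `K (Uᵀ Z V - Uᵀ D V)`, makes all terms without `D` cancel.
  set L := Bi * (Uᵀ * Z * Q) with hL
  set K := P * (Xb * V) * Bbi with hK
  have hBL : Uᵀ * Z * V * L = Uᵀ * Z * Q := by
    rw [hL, ← Matrix.mul_assoc, hBi', Matrix.one_mul]
  have hKB : K * (Uᵀ * Xb * V) = P * (Xb * V) := by
    rw [hK, Matrix.mul_assoc, hBbi, Matrix.mul_one]
  have hKX : K * (Uᵀ * Xb * Q) = W := by
    rw [hW]
    conv_rhs => rw [hXb]
    rw [hK]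
    simp only [Matrix.mul_assoc]
  have hZV : Z * V * Bi * (Uᵀ * Z) = Z * (V * Vᵀ) + Z * V * L := by
    have : Z * V * Bi * (Uᵀ * Z) = Z * V * (Bi * (Uᵀ * Z * V)) * Vᵀ + Z * V * L := by
      rw [hL, hQ, Matrix.mul_sub, Matrix.mul_sub, Matrix.mul_sub, Matrix.mul_one]
      simp only [Matrix.mul_assoc]
      abel
    rw [this, hBi, Matrix.mul_one, Matrix.mul_assoc]
  have hZsplit : Z = Z * (V * Vᵀ) + U * (Uᵀ * Z * Q) := by
    have h1 : P * Z * Q = 0 := hZ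
    rw [hP, Matrix.sub_mul, Matrix.sub_mul, Matrix.one_mul, sub_eq_zero] at h1
    have h2 : U * (Uᵀ * Z * Q) = Z * Q := by
      rw [h1]; simp only [Matrix.mul_assoc]
    rw [h2, hQ, Matrix.mul_sub, Matrix.mul_one]
    abel
  have hPZV : Z * V * L = U * (Uᵀ * Z * Q) + P * (Z * V) * L := by
    rw [← hBL, hP, Matrix.sub_mul, Matrix.one_mul, Matrix.sub_mul]
    simp only [Matrix.mul_assoc]
    abel
  have e1 : P * D * V * L = P * (Z * V) * L - P * (Xb * V) * L := by
    rw [Matrix.mul_assoc P D V, hDV, Matrix.mul_sub, Matrix.sub_mul]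
  have e2 : K * (Uᵀ * D * V) * L = K * (Uᵀ * Z * Q) - P * (Xb * V) * L := by
    rw [hUD, Matrix.sub_mul, Matrix.mul_sub, Matrix.sub_mul, hKB, Matrix.mul_assoc K _ L, hBL]
  have e3 : K * (Uᵀ * D * Q) = K * (Uᵀ * Z * Q) - W := by
    rw [hUD, Matrix.sub_mul, Matrix.mul_sub, hKX]
  have e4 : Z * V * Bi * (Uᵀ * Z) = Z + P * (Z * V) * L := by
    rw [hZV, hPZV, ← add_assoc, ← hZsplit]
  rw [e1, e2, e3, e4, hD]
  abel

/-- Each term of `update_error_eq` is `D` multiplied by projections, by `L` or by `K`; closeness of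
`X` and `Z` to the target makes `L` and `K` small. -/
theorem frobNorm_update_error_le {Bdag : Matrix (Fin r) (Fin r) ℝ}
    (h : IsSVD Xb Ub s Vb) (hc : 0 < c) (hs : ∀ i, c ≤ s i)
    (hU : OrthonormalCols U) (hV : OrthonormalCols V) (hXU : U * Uᵀ * X = X)
    (hXV : X * (V * Vᵀ) = X) (he : specNorm (X - Xb) ≤ 1 / 4 * c) (hZ : IsTangent U V Z)
    (hD : frobNorm (Z - Xb + (1 - U * Uᵀ) * Xb * (1 - V * Vᵀ)) ≤ 0.085 * c)
    (hB : IsMoorePenrose (Uᵀ * Z * V) Bdag) :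
    frobNorm (Z * V * Bdag * (Uᵀ * Z) - Xb) ≤
      √5 * frobNorm (Z - Xb + (1 - U * Uᵀ) * Xb * (1 - V * Vᵀ)) := by
  set W := (1 - U * Uᵀ) * Xb * (1 - V * Vᵀ) with hW
  set D := Z - Xb + W with hDdef
  have hD0 := frobNorm_nonneg D
  have hUD : Uᵀ * D = Uᵀ * Z - Uᵀ * Xb := by
    rw [hDdef, hW, Matrix.mul_add, ← Matrix.mul_assoc, ← Matrix.mul_assoc, hU.transpose_mul_compl,
      Matrix.zero_mul, Matrix.zero_mul, add_zero, Matrix.mul_sub]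
  obtain ⟨hbb, hXb⟩ := h.core_boundedBelow hc hs hU hV hXU hXV (by linarith)
  -- The sine is at most `1/4`, and `1 - (1/4)² = 15/16`.
  have hbb' : BoundedBelow (15 / 16 * c) (Uᵀ * Xb * V) := by
    refine hbb.mono ?_
    have h1 : specNorm (X - Xb) / c ≤ 1 / 4 := by rwa [div_le_iff₀ hc]
    have h2 := pow_le_pow_left₀ (div_nonneg (specNorm_nonneg (X - Xb)) hc.le) h1 2
    nlinarith
  have hUDV : specNorm (Uᵀ * D * V) ≤ 0.085 * c := by
    have h1 := specNorm_mul_le_of_le (specNorm_mul_le_of_le hU.specNorm_transpose_le_one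
      ((specNorm_le_frobNorm D).trans hD)) hV.specNorm_le_one
    linarith
  -- `15/16 - 0.085 = 0.8525`.
  have hB' : BoundedBelow (0.85 * c) (Uᵀ * Z * V) := by
    have h1 := hbb'.add hUDV
    rw [hUD, Matrix.sub_mul, add_sub_cancel] at h1
    exact h1.mono (by linarith)
  have hc1 : 0 < 15 / 16 * c := by positivity
  have hc2 : 0 < 0.85 * c := by positivity
  have hu := hB'.isUnit_det hc2
  have hub := hbb'.isUnit_det hc1
  rw [hB.eq_inv hu, update_error_eq hU hV hZ hW hDdef (Matrix.nonsing_inv_mul _ hu)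
    (Matrix.mul_nonsing_inv _ hu) (Matrix.nonsing_inv_mul _ hub) hXb]
  -- The bound is `(0.25 + 0.085) / 0.85 < 0.4`.
  have hL : specNorm ((Uᵀ * Z * V)⁻¹ * (Uᵀ * Z * (1 - V * Vᵀ))) ≤ 0.4 := by
    have e : Uᵀ * Z * (1 - V * Vᵀ) =
        Uᵀ * -((X - Xb) * (1 - V * Vᵀ)) + Uᵀ * D * (1 - V * Vᵀ) := by
      rw [hUD, ← mul_compl_eq hXV, Matrix.sub_mul, ← Matrix.mul_assoc]; abel
    have h1 : specNorm (Uᵀ * Z * (1 - V * Vᵀ)) ≤ 0.335 * c := by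
      rw [e]
      refine (specNorm_add_le _ _).trans ?_
      have h2 := specNorm_mul_le_of_le hU.specNorm_transpose_le_one
        ((specNorm_neg _).trans_le (specNorm_mul_le_of_le he hV.specNorm_compl_le_one))
      have h3 := specNorm_mul_le_of_le (specNorm_mul_le_of_le hU.specNorm_transpose_le_one
        ((specNorm_le_frobNorm D).trans hD)) hV.specNorm_compl_le_one
      linarith
    refine (specNorm_mul_le_of_le (hB'.specNorm_inv_le hc2) h1).trans ?_
    rw [inv_mul_le_iff₀ hc2]
    linarith
  -- The bound is `(1/4) / (15/16) = 4/15 < 0.27`.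
  have hK : specNorm ((1 - U * Uᵀ) * (Xb * V) * (Uᵀ * Xb * V)⁻¹) ≤ 0.27 := by
    have h1 : specNorm ((1 - U * Uᵀ) * (Xb * V)) ≤ 1 / 4 * c := by
      rw [← Matrix.mul_assoc, compl_mul_eq hXU]
      have := specNorm_mul_le_of_le ((specNorm_neg _).trans_le
        (specNorm_mul_le_of_le hU.specNorm_compl_le_one he)) hV.specNorm_le_one
      linarith
    refine (specNorm_mul_le_of_le h1 (hbb'.specNorm_inv_le hc1)).trans ?_
    rw [mul_inv_le_iff₀ hc1]
    linarith
  set L := (Uᵀ * Z * V)⁻¹ * (Uᵀ * Z * (1 - V * Vᵀ))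
  set K := (1 - U * Uᵀ) * (Xb * V) * (Uᵀ * Xb * V)⁻¹
  have t1 := frobNorm_mul_le_right_of_le (frobNorm_mul_le_right_of_le (frobNorm_mul_le_left_of_le
    hU.specNorm_compl_le_one (le_refl (frobNorm D))) hV.specNorm_le_one) hL
  have t2 := frobNorm_mul_le_right_of_le (frobNorm_mul_le_left_of_le hK
    (frobNorm_mul_le_right_of_le (frobNorm_mul_le_left_of_le
    hU.specNorm_transpose_le_one (le_refl (frobNorm D))) hV.specNorm_le_one)) hL
  have t3 := frobNorm_mul_le_left_of_le hK
    (frobNorm_mul_le_right_of_le (frobNorm_mul_le_left_of_le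
    hU.specNorm_transpose_le_one (le_refl (frobNorm D))) hV.specNorm_compl_le_one)
  -- The four terms add up to `1 + 0.4 + 0.27 * 0.4 + 0.27 = 1.778 < 2`, so the triangle inequality
  -- suffices.
  have h5 : (2 : ℝ) ≤ √5 := Real.le_sqrt_of_sq_le (by norm_num)
  have h6 := mul_le_mul_of_nonneg_right h5 hD0
  rw [sub_eq_add_neg (D + _)]
  refine (frobNorm_add_le _ _).trans ((add_le_add_left ((frobNorm_add_le _ _).trans
    (add_le_add_left (frobNorm_add_le _ _) _)) _).trans ?_)
  rw [frobNorm_neg]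
  linarith

end Step

/-! ### One complete step and passage to the limit. -/

theorem measAdj_neg (A : Fin n → Matrix (Fin p) (Fin q) ℝ) (z : EuclideanSpace ℝ (Fin n)) :
    measAdj A (-z) = -measAdj A z := by
  simp [measAdj]

theorem tendsto_of_frobNorm_le {X : ℕ → Matrix (Fin p) (Fin q) ℝ} {Y : Matrix (Fin p) (Fin q) ℝ}
    {u : ℕ → ℝ} (h : ∀ t, frobNorm (X t - Y) ≤ u t) (hu : Tendsto u atTop (𝓝 0)) :
    Tendsto X atTop (𝓝 Y) := by
  refine tendsto_pi_nhds.2 fun i => tendsto_pi_nhds.2 fun j => ?_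
  rw [tendsto_iff_norm_sub_tendsto_zero]
  refine squeeze_zero (fun _ => norm_nonneg _) (fun t => ?_) hu
  refine le_trans ?_ (h t)
  refine le_of_sq_le_sq ?_ (frobNorm_nonneg _)
  rw [frobNorm_sq, frobInner, Real.norm_eq_abs, sq_abs, sq]
  exact (Finset.single_le_sum (f := fun k => (X t - Y) i k * (X t - Y) i k)
    (fun k _ => mul_self_nonneg _) (Finset.mem_univ j)).trans
    (Finset.single_le_sum (f := fun l => ∑ k, (X t - Y) l k * (X t - Y) l k)
      (fun l _ => Finset.sum_nonneg fun k _ => mul_self_nonneg _) (Finset.mem_univ i))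

/-- One RISRO step near a stationary point. -/
theorem IsRisroStep.frobNorm_sub_le {A : Fin n → Matrix (Fin p) (Fin q) ℝ}
    {y : EuclideanSpace ℝ (Fin n)} {U U' : Matrix (Fin p) (Fin r) ℝ}
    {V V' : Matrix (Fin q) (Fin r) ℝ} {X X' Xb : Matrix (Fin p) (Fin q) ℝ}
    (hstep : IsRisroStep A y U V U' V' X') (hr : 1 ≤ r) (hXb : IsStationary A y r Xb)
    (hRIP : RIP A (2 * r)) (hU : OrthonormalCols U) (hV : OrthonormalCols V)
    (hXU : U * Uᵀ * X = X) (hXV : X * (V * Vᵀ) = X)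
    (h1 : frobNorm (X - Xb) ≤ 1 / 4 * sigma r Xb)
    (h2 : 4 * √5 * ricConst A (3 * r) * frobNorm (X - Xb) ≤
      (1 - ricConst A (2 * r)) * sigma r Xb)
    (h3 : frobNorm (measAdj A (y - measMap A Xb)) ≤
      (1 - ricConst A (2 * r)) / (4 * √5) * sigma r Xb) :
    0 ≤ ricConst A (3 * r) ∧
    (OrthonormalCols U' ∧ OrthonormalCols V' ∧ U' * U'ᵀ * X' = X' ∧ X' * (V' * V'ᵀ) = X') ∧
    frobNorm (X' - Xb) ≤ √5 * specNorm (X - Xb) / ((1 - ricConst A (2 * r)) * sigma r Xb) *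
      (ricConst A (3 * r) * frobNorm (X - Xb) +
        2 * frobNorm (measAdj A (y - measMap A Xb))) ∧
    frobNorm (X' - Xb) ≤ 3 / 4 * frobNorm (X - Xb) := by
  obtain ⟨hrank, Ub, s, Vb, hsvd, hgU, hgV⟩ := hXb
  have hp : r ≤ p := hrank ▸ Xb.rank_le_height
  have hq : r ≤ q := hrank ▸ Xb.rank_le_width
  have hc := sigma_pos hr hrank
  have hs := hsvd.sigma_le hrank
  set c := sigma r Xb with hcdef
  set a := ricConst A (2 * r) with ha
  set b := ricConst A (3 * r) with hb
  set G := measAdj A (y - measMap A Xb) with hG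
  have hb0 : 0 ≤ b :=
    hRIP.1.trans (ricConst_mono A (hr.trans hp) (hr.trans hq) (by omega) (by omega))
  have ha1 : 0 < 1 - a := sub_pos.2 hRIP.2
  have hgrad : lsGradient A y Xb = -G := by
    rw [lsGradient, hG, ← measAdj_neg, neg_sub]
  have hGU : Ubᵀ * G = 0 := by
    rw [hgrad, Matrix.transpose_neg, Matrix.neg_mul, neg_eq_zero] at hgU
    rw [← Matrix.transpose_inj, Matrix.transpose_mul]
    simpa using hgU
  have hGV : G * Vb = 0 := by
    rwa [hgrad, Matrix.neg_mul, neg_eq_zero] at hgV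
  have he4 : specNorm (X - Xb) ≤ 1 / 4 * c := (specNorm_le_frobNorm _).trans h1
  obtain ⟨hinv, Z, hZ, hopt, P, hP, hX'⟩ := hstep.exists_tangent hU hV hp hq
  have hD := frobNorm_tangent_error_le
    (isLeast_ricConst A (2 * r) (hr.trans hp) (hr.trans hq) (by omega)).1
    (isLeast_ricConst A (3 * r) (hr.trans hp) (hr.trans hq) (by omega)).1 hb0 hsvd hc hs hU hV
    hXU hXV (by linarith) hGU hGV hZ hopt
  rw [← hG, ← ha, ← hb] at hD
  set d := frobNorm (Z - Xb + (1 - U * Uᵀ) * Xb * (1 - V * Vᵀ)) with hd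
  set f := frobNorm (X - Xb) with hf
  set e := specNorm (X - Xb) with he
  set g := frobNorm G with hg
  have h5 : 0 < √5 := by positivity
  have h55 : √5 * √5 = 5 := Real.mul_self_sqrt (by norm_num)
  have hef : e ≤ f := specNorm_le_frobNorm _
  have he0 : 0 ≤ e := specNorm_nonneg _
  -- One unit of `(1 - a) c` comes from the bound on `f`, two from the bound on `g`; this is where
  -- the rate `3/4` originates.
  have hS : 4 * √5 * (b * f + 2 * g) ≤ 3 * ((1 - a) * c) := by
    have : 4 * √5 * g ≤ (1 - a) * c := by
      rw [div_mul_eq_mul_div, le_div_iff₀ (by positivity)] at h3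
      linarith
    linarith
  have hdS : d ≤ e * (b * f + 2 * g) / ((1 - a) * c) := by
    rw [le_div_iff₀ (by positivity)]
    calc d * ((1 - a) * c) = ((1 - a) * d) * c := by ring
      _ ≤ (e / c * (b * f + 2 * g)) * c := mul_le_mul_of_nonneg_right hD hc.le
      _ = e * (b * f + 2 * g) := by field_simp
  have hde : √5 * d ≤ 3 / 4 * e := by
    have h6 : e * (b * f + 2 * g) / ((1 - a) * c) ≤ 3 * e / (4 * √5) := by
      rw [div_le_div_iff₀ (by positivity) (by positivity)]
      nlinarith [mul_le_mul_of_nonneg_left hS he0]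
    have h7 := hdS.trans h6
    rw [le_div_iff₀ (by positivity)] at h7
    linarith
  -- `√5 d ≤ 3/4 * e ≤ 3/16 * c`, and `0.1875 / 2.23 < 0.085`.
  have hd' : d ≤ 0.085 * c := by
    have h8 : (2.23 : ℝ) ≤ √5 := Real.le_sqrt_of_sq_le (by norm_num)
    have hd0 : 0 ≤ d := frobNorm_nonneg _
    nlinarith [mul_le_mul_of_nonneg_right h8 hd0]
  have hfin := frobNorm_update_error_le hsvd hc hs hU hV hXU hXV he4 hZ hd' hP
  rw [← hX', ← hd] at hfin
  refine ⟨hb0, hinv, hfin.trans ?_, hfin.trans (hde.trans (by linarith))⟩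
  calc √5 * d ≤ √5 * (e * (b * f + 2 * g) / ((1 - a) * c)) :=
        mul_le_mul_of_nonneg_left hdS h5.le
    _ = √5 * e / ((1 - a) * c) * (b * f + 2 * g) := by ring

end Risro

theorem mainTheorem1 (n p₁ p₂ r : ℕ) (hr : 1 ≤ r)
    (A : Fin n → Matrix (Fin p₁) (Fin p₂) ℝ) (y : EuclideanSpace ℝ (Fin n))
    (Xbar : Matrix (Fin p₁) (Fin p₂) ℝ) (hXbar : Risro.IsStationary A y r Xbar)
    (hRIP : Risro.RIP A (2 * r))
    (X : ℕ → Matrix (Fin p₁) (Fin p₂) ℝ) (hX : Risro.IsRisroSequence A y r X)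
    -- the two initialization inequalities, the second one cleared of its denominator `R_{3r}`
    (hinit₁ : Risro.frobNorm (X 0 - Xbar) ≤ 1 / 4 * Risro.sigma r Xbar)
    (hinit₂ : 4 * √5 * Risro.ricConst A (3 * r) * Risro.frobNorm (X 0 - Xbar) ≤
      (1 - Risro.ricConst A (2 * r)) * Risro.sigma r Xbar)
    (hres : Risro.frobNorm (Risro.measAdj A (y - Risro.measMap A Xbar)) ≤
      (1 - Risro.ricConst A (2 * r)) / (4 * √5) * Risro.sigma r Xbar) :
    Tendsto X atTop (𝓝 Xbar) ∧
    (∀ t, Risro.frobNorm (X (t + 1) - Xbar) ≤ 3 / 4 * Risro.frobNorm (X t - Xbar)) ∧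
    (∀ t, Risro.frobNorm (X (t + 1) - Xbar) ^ 2 ≤
      5 * Risro.specNorm (X t - Xbar) ^ 2 /
          ((1 - Risro.ricConst A (2 * r)) ^ 2 * Risro.sigma r Xbar ^ 2) *
        (Risro.ricConst A (3 * r) ^ 2 * Risro.frobNorm (X t - Xbar) ^ 2 +
          4 * Risro.ricConst A (3 * r) *
            Risro.frobNorm (Risro.measAdj A (y - Risro.measMap A Xbar)) *
            Risro.frobNorm (X t - Xbar) +
          4 * Risro.frobNorm (Risro.measAdj A (y - Risro.measMap A Xbar)) ^ 2)) ∧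
    (y - Risro.measMap A Xbar = 0 →
      ∀ t, Risro.frobNorm (X (t + 1) - Xbar) ≤
        √5 * Risro.ricConst A (3 * r) / ((1 - Risro.ricConst A (2 * r)) * Risro.sigma r Xbar) *
          Risro.frobNorm (X t - Xbar) ^ 2) := by
  obtain ⟨U, V, ⟨s, hU₀, hV₀, -, hX₀⟩, hstep⟩ := hX
  have hUU : (U 0)ᵀ * U 0 = 1 := hU₀
  have hVV : (V 0)ᵀ * V 0 = 1 := hV₀
  have hXU₀ : U 0 * (U 0)ᵀ * X 0 = X 0 := by
    rw [hX₀, Matrix.mul_assoc (U 0), Matrix.mul_assoc (U 0) (Matrix.diagonal s),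
      ← Matrix.mul_assoc (U 0)ᵀ, hUU, Matrix.one_mul]
  have hXV₀ : X 0 * (V 0 * (V 0)ᵀ) = X 0 := by
    rw [hX₀, Matrix.mul_assoc _ (V 0)ᵀ, ← Matrix.mul_assoc (V 0)ᵀ, hVV, Matrix.one_mul]
  set f : ℕ → ℝ := fun t => Risro.frobNorm (X t - Xbar) with hf
  have hf0 : ∀ t, 0 ≤ f t := fun t => Risro.frobNorm_nonneg _
  have hb0 := ((hstep 0).frobNorm_sub_le hr hXbar hRIP hU₀ hV₀ hXU₀ hXV₀ hinit₁ hinit₂ hres).1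
  have h5 : 0 < √5 := by positivity
  have hle : ∀ t, f t ≤ f 0 → f t ≤ 1 / 4 * Risro.sigma r Xbar ∧
      4 * √5 * Risro.ricConst A (3 * r) * f t ≤
        (1 - Risro.ricConst A (2 * r)) * Risro.sigma r Xbar := fun t ht =>
    ⟨ht.trans hinit₁, (mul_le_mul_of_nonneg_left ht (by positivity)).trans hinit₂⟩
  -- The induction carries only that `U t` and `V t` span spaces containing the column and row
  -- spaces of `X t`, not that they are singular factors; the error never exceeds its initial value,
  -- so the initialization bounds persist.
  have hinv : ∀ t, (Risro.OrthonormalCols (U t) ∧ Risro.OrthonormalCols (V t) ∧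
      U t * (U t)ᵀ * X t = X t ∧ X t * (V t * (V t)ᵀ) = X t) ∧ f t ≤ f 0 := by
    intro t
    induction t with
    | zero => exact ⟨⟨hU₀, hV₀, hXU₀, hXV₀⟩, le_rfl⟩
    | succ t ih =>
      obtain ⟨⟨hU, hV, hXU, hXV⟩, ht⟩ := ih
      obtain ⟨-, h1, -, h2⟩ := (hstep t).frobNorm_sub_le hr hXbar hRIP hU hV hXU hXV
        (hle t ht).1 (hle t ht).2 hres
      have h3 := hf0 t
      have h2' : f (t + 1) ≤ 3 / 4 * f t := h2
      exact ⟨h1, by linarith⟩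
  have hmain := fun t => ((hstep t).frobNorm_sub_le hr hXbar hRIP (hinv t).1.1 (hinv t).1.2.1
    (hinv t).1.2.2.1 (hinv t).1.2.2.2 (hle t (hinv t).2).1 (hle t (hinv t).2).2 hres).2.2
  have hgeom : ∀ t, f t ≤ f 0 * (3 / 4) ^ t := by
    intro t
    induction t with
    | zero => simp
    | succ t ih =>
      have h1 : f (t + 1) ≤ 3 / 4 * f t := (hmain t).2
      rw [pow_succ]
      linarith
  refine ⟨?_, fun t => (hmain t).2, fun t => ?_, fun hε t => ?_⟩
  · refine Risro.tendsto_of_frobNorm_le hgeom ?_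
    simpa using (tendsto_pow_atTop_nhds_zero_of_lt_one (by norm_num : (0 : ℝ) ≤ 3 / 4)
      (by norm_num)).const_mul (f 0)
  -- The claimed bound is exactly the square of the one-step bound, with `(R_{3r} f + 2g)²`
  -- expanded.
  · refine (pow_le_pow_left₀ (hf0 (t + 1)) (hmain t).1 2).trans (le_of_eq ?_)
    rw [mul_pow, div_pow, mul_pow, mul_pow, Real.sq_sqrt (by norm_num)]
    ring
  · have h1 := (hmain t).1
    have hG : Risro.frobNorm (Risro.measAdj A (y - Risro.measMap A Xbar)) = 0 := by
      have h2 : Risro.measAdj A (y - Risro.measMap A Xbar) = 0 := by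
        rw [hε]; simp [Risro.measAdj]
      rw [← pow_eq_zero_iff two_ne_zero, Risro.frobNorm_sq, h2, Risro.frobInner_zero_right]
    rw [hG, mul_zero, add_zero] at h1
    refine h1.trans ?_
    have hc := Risro.sigma_pos hr hXbar.1
    have ha : 0 < 1 - Risro.ricConst A (2 * r) := sub_pos.2 hRIP.2
    calc _ = √5 * Risro.ricConst A (3 * r) /
          ((1 - Risro.ricConst A (2 * r)) * Risro.sigma r Xbar) *
          (Risro.specNorm (X t - Xbar) * f t) := by ring
      _ ≤ _ := by
        rw [sq]
        exact mul_le_mul_of_nonneg_left (mul_le_mul_of_nonneg_right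
          (Risro.specNorm_le_frobNorm _) (hf0 t)) (by positivity)
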